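/- **Setting.** Let $(\epsilon_k)_{k\in\mathbb Z}$ be i.i.d. random elements, $\mathcal F_i=(\ldots,\epsilon_{i-1},\epsilon_i)$, let $G_n$ be measurable real-valued functions and $e_{i,n}=G_n(\mathcal F_i)$, with (common) distribution function $F_n(u)=\mathrm{pr}(e_{i,n}\le u)$ satisfying $F_n(0)=1-\alpha_n$. Let $x_{i,n}\in\mathbb R^p$, $1\le i\le n$, be deterministic with $\Sigma_n=n^{-1}\sum_{i=1}^n x_{i,n}x_{i,n}^\top$ non-singular for all large $n$, and put $z_{i,n}=\Sigma_n^{-1/2}x_{i,n}$ and $r_n=\max_{1\le i\le n}|z_{i,n}|$. Let $\gamma_{i,n}>0$ be deterministic with $n^{-1}\sum_{i=1}^n\gamma_{i,n}=1$. Let $\psi_{1-\alpha}(u)=(1-\alpha)-\mathbb 1_{\{u\le 0\}}$ and, for $\varphi\in\mathbb R^p$, $$M_n(\varphi)=\sum_{i=1}^n\Big[\psi_{1-\alpha_n}(\gamma_{i,n}e_{i,n}-z_{i,n}^\top\varphi)-E\{\psi_{1-\alpha_n}(\gamma_{i,n}e_{i,n}-z_{i,n}^\top\varphi)\mid\mathcal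 F_{i-1}\}\Big]z_{i,n}.$$ All conditional expectations and probabilities given $\mathcal F_{i-1}$ are computed from a regular conditional distribution of $e_{i,n}$ given $\mathcal F_{i-1}$. **Lemma.** Assume that $\alpha_n\to0$ and $n\alpha_n\to\infty$, and that there are constants $0<c_{\gamma,1}\le c_{\gamma,2}<\infty$ with $c_{\gamma,1}\le\gamma_{i,n}\le c_{\gamma,2}$ for all $1\le i\le n$ and all large $n$. Assume further that $\iota_{1,n}(u;\mathcal F_0)=\mathrm{pr}(e_{1,n}>u\mid\mathcal F_0)$ is stochastically Lipschitz continuous near zero: there is an $\varepsilon_0>0$, not depending on $n$, such that $$L_{0,n}=\sup_{-\varepsilon_0\le u_1<u_2\le\varepsilon_0}\frac{|\iota_{1,n}(u_2;\mathcal F_0)-\iota_{1,n}(u_1;\mathcal F_0)|}{|u_2-u_1|}$$ is bounded in $\mathcal L^1$, that is, $\limsup_{n\to\infty}E(L_{0,n})<\infty$. Then, for every sequence $\delta_n>0$ with $\delta_nr_n=o(1)$, $$\sup_{|\varphi|\le\delta_n}|M_n(\varphi)-M_n(0)|=O_p\big[\{\varrho_n(\delta_n)\}^{1/2}\log n+r_n^2n^{-3}\big],$$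 where $$\varrho_n(\delta)=\sum_{i=1}^n|z_{i,n}|^2\{F_n(c_{\gamma,1}^{-1}|z_{i,n}|\delta)-F_n(-c_{\gamma,1}^{-1}|z_{i,n}|\delta)\}.$$ Here $X_n=O_p(b_n)$ means that for every $\eta>0$ there is a $C<\infty$ with $\mathrm{pr}(X_n>Cb_n)\le\eta$ for all large $n$. -/

import Mathlib

open MeasureTheory ProbabilityTheory Filter Topology
open scoped NNReal ENNReal

namespace HighQuantile

noncomputable section

/-- The sample second-moment matrix `Σ_n = n⁻¹ ∑_{i=1}^n x_{i,n} x_{i,n}ᵀ`. The array is indexed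
as `x n i`, and only the entries with `1 ≤ i ≤ n` are used. -/
def secondMoment {p : ℕ} (x : ℕ → ℕ → EuclideanSpace ℝ (Fin p)) (n : ℕ) : Matrix (Fin p) (Fin p) ℝ :=
  (n : ℝ)⁻¹ • ∑ i ∈ Finset.Icc 1 n, Matrix.vecMulVec (x n i).ofLp (x n i).ofLp

/-- The rescaled regressors `z_{i,n} = Σ_n^{-1/2} x_{i,n}`; the inverse square root of the
symmetric matrix `Σ_n` is taken by the functional calculus. -/
def rescaled {p : ℕ} (x : ℕ → ℕ → EuclideanSpace ℝ (Fin p)) (n i : ℕ) :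
    EuclideanSpace ℝ (Fin p) :=
  WithLp.toLp 2 ((cfc (fun t : ℝ => (Real.sqrt t)⁻¹) (secondMoment x n)).mulVec (x n i).ofLp)

/-- `r_n = max_{1 ≤ i ≤ n} |z_{i,n}|`. -/
def maxNorm {p : ℕ} (z : ℕ → ℕ → EuclideanSpace ℝ (Fin p)) (n : ℕ) : ℝ :=
  (((Finset.Icc 1 n).sup fun i => ‖z n i‖₊ : ℝ≥0) : ℝ)

/-- The left derivative `ψ_{1-α}(u) = (1 - α) - 1{u ≤ 0}` of the check function. -/
def psi (α u : ℝ) : ℝ := (1 - α) - if u ≤ 0 then 1 else 0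

variable {Ω E : Type*} [MeasurableSpace Ω] [MeasurableSpace E]

/-- The history `ℱ_i = (…, ε_{i-1}, ε_i)`, listed backwards in time. -/
def past (ε : ℤ → Ω → E) (i : ℤ) (ω : Ω) : ℕ → E := fun k => ε (i - (k : ℤ)) ω

/-- The output `e_{i,n} = G_n(ℱ_i)`. -/
def output (ε : ℤ → Ω → E) (G : ℕ → (ℕ → E) → ℝ) (n : ℕ) (i : ℤ) (ω : Ω) : ℝ :=
  G n (past ε i ω)

/-- The marginal distribution function `F_n(u) = pr(e_{k,n} ≤ u)`, which does not depend on `k`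
when the innovations are i.i.d. -/
def margCdf (μ : Measure Ω) (ε : ℤ → Ω → E) (G : ℕ → (ℕ → E) → ℝ) (n : ℕ) (u : ℝ) : ℝ :=
  μ.real {ω | output ε G n 0 ω ≤ u}

/-- The regular conditional distribution of `e_{i,n}` given `ℱ_{i-1}`, as a random measure.
All the conditional probabilities and expectations below are computed from it, so that suprema
over uncountably many of them are meaningful. -/
def condLaw (μ : Measure Ω) [IsFiniteMeasure μ] (ε : ℤ → Ω → E) (G : ℕ → (ℕ → E) → ℝ)
    (n : ℕ) (i : ℤ) (ω : Ω) : Measure ℝ :=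
  condDistrib (output ε G n i) (past ε (i - 1)) μ (past ε (i - 1) ω)

/-- For each fixed threshold, the integral against `condLaw` is a version of the conditional
expectation given `ℱ_{i-1}`. -/
theorem condExp_psi_ae_eq (μ : Measure Ω) [IsFiniteMeasure μ]
    (ε : ℤ → Ω → E) (hε : ∀ k, Measurable (ε k)) (G : ℕ → (ℕ → E) → ℝ)
    (hG : ∀ n, Measurable (G n)) (n : ℕ) (i : ℤ) (a g t : ℝ) :
    μ[fun ω => psi a (g * output ε G n i ω - t) |
        MeasurableSpace.comap (past ε (i - 1)) inferInstance]
      =ᵐ[μ] fun ω => ∫ e, psi a (g * e - t) ∂(condLaw μ ε G n i ω) := by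
  have hp : ∀ j, Measurable (past ε j) := fun j => measurable_pi_lambda _ fun k => hε _
  have hout : Measurable (output ε G n i) := (hG n).comp (hp i)
  have hm : Measurable fun e : ℝ => psi a (g * e - t) := by
    unfold psi
    refine measurable_const.sub (Measurable.ite ?_ measurable_const measurable_const)
    exact measurableSet_le (by fun_prop) measurable_const
  refine condExp_ae_eq_integral_condDistrib (hp (i - 1)) hout.aemeasurable
    (f := fun e => psi a (g * e - t)) hm.stronglyMeasurable ?_
  refine Integrable.of_bound (hm.comp hout).aestronglyMeasurable (|1 - a| + 1)
    (.of_forall fun ω => ?_)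
  simp only [psi, Real.norm_eq_abs]
  split_ifs
  · exact (abs_sub _ _).trans (by simp)
  · simp

/-- `ι_{1,n}(u; ℱ_0) = pr(e_{1,n} > u ∣ ℱ_0)`. -/
def condTail (μ : Measure Ω) [IsFiniteMeasure μ] (ε : ℤ → Ω → E) (G : ℕ → (ℕ → E) → ℝ)
    (n : ℕ) (u : ℝ) (ω : Ω) : ℝ :=
  (condLaw μ ε G n 1 ω).real (Set.Ioi u)

/-- The random Lipschitz constant `L_{0,n}` of `u ↦ ι_{1,n}(u; ℱ_0)` on `[-ε₀, ε₀]`,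
with values in `[0, ∞]`. -/
def lipConst (μ : Measure Ω) [IsFiniteMeasure μ] (ε : ℤ → Ω → E) (G : ℕ → (ℕ → E) → ℝ)
    (ε₀ : ℝ) (n : ℕ) (ω : Ω) : ℝ≥0∞ :=
  ⨆ (u₁ : ℝ) (u₂ : ℝ) (_ : -ε₀ ≤ u₁ ∧ u₁ < u₂ ∧ u₂ ≤ ε₀),
    ENNReal.ofReal (|condTail μ ε G n u₂ ω - condTail μ ε G n u₁ ω| / |u₂ - u₁|)

/-- The martingale part
`M_n(φ) = ∑_{i=1}^n [ψ(γ_{i,n} e_{i,n} - z_{i,n}ᵀ φ)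
  - E{ψ(γ_{i,n} e_{i,n} - z_{i,n}ᵀ φ) ∣ ℱ_{i-1}}] z_{i,n}`, with `ψ = ψ_{1-α_n}`. -/
def martPart {p : ℕ} (μ : Measure Ω) [IsFiniteMeasure μ] (ε : ℤ → Ω → E)
    (G : ℕ → (ℕ → E) → ℝ) (α : ℕ → ℝ) (γ : ℕ → ℕ → ℝ)
    (z : ℕ → ℕ → EuclideanSpace ℝ (Fin p)) (n : ℕ) (φ : EuclideanSpace ℝ (Fin p)) (ω : Ω) :
    EuclideanSpace ℝ (Fin p) :=
  ∑ i ∈ Finset.Icc 1 n,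
    (psi (α n) (γ n i * output ε G n i ω - inner ℝ (z n i) φ)
      - ∫ e, psi (α n) (γ n i * e - inner ℝ (z n i) φ) ∂(condLaw μ ε G n i ω)) • z n i

/-- `ϱ_n(δ) = ∑_{i=1}^n |z_{i,n}|² {F_n(c⁻¹ |z_{i,n}| δ) - F_n(-c⁻¹ |z_{i,n}| δ)}`. -/
def rho {p : ℕ} (μ : Measure Ω) (ε : ℤ → Ω → E) (G : ℕ → (ℕ → E) → ℝ) (c : ℝ)
    (z : ℕ → ℕ → EuclideanSpace ℝ (Fin p)) (n : ℕ) (δ : ℝ) : ℝ :=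
  ∑ i ∈ Finset.Icc 1 n, ‖z n i‖ ^ 2 *
    (margCdf μ ε G n (c⁻¹ * ‖z n i‖ * δ) - margCdf μ ε G n (-(c⁻¹ * ‖z n i‖ * δ)))

/-- `X_n = O_p(b_n)` for `[0, ∞]`-valued `X_n` and deterministic `b_n ≥ 0`. -/
def IsBigOp (μ : Measure Ω) (X : ℕ → Ω → ℝ≥0∞) (b : ℕ → ℝ) : Prop :=
  ∀ η : ℝ≥0∞, 0 < η → ∃ C : ℝ≥0, ∀ᶠ n in atTop,
    μ {ω | (C : ℝ≥0∞) * ENNReal.ofReal (b n) < X n ω} ≤ η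

end

end HighQuantile

/-! The increment of the martingale part is a centred sum of step functions, each supported on a
window of outputs around zero of half-width proportional to `‖z n i‖ * δ n`. Its predictable
variance has expectation at most `rho`, so a Freedman bound suggests the order √ϱ · log n, uniformly
over a net of polynomially many levels.

Two obstacles remain. A summand may be as large as r_n, which would spoil the linear term of
Freedman's inequality. Vectors are therefore truncated at a level s with s² ≥ ϱ. A vector longer
than s has norm at most ‖z‖²/s, so the discarded part has expected size at most 2ϱ/s ≤ 2s and
Markov's inequality disposes of it. With summands bounded by s and variance by K s², the tilt 1/(2s)
gives the tail e^{-a/(2s)+K/4}.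

Between net points, the change of a step is dominated by the indicator of a short interval
(`abs_stepDiff_sub_le`). The centred indicators obey the same Freedman bound, while their
compensator is controlled by the stochastic Lipschitz constant; mesh of order n⁻⁴ makes it of order
r_n² n⁻³.

By stationarity a single kernel gives all the conditional laws (`condLaw_eq`), so one Lipschitz
moment serves every index. `measure_sum_output_ge_le` is the Freedman bound,
`norm_sum_centered_stepDiff_le` the deterministic splitting, and `measure_sup_martPart_le` combines
them for fixed n. -/

namespace HighQuantile

/-! ### Freedman's inequality from an exponential supermartingale. -/

section ExponentialBound

/-- A centred variable dominated by `w` times the indicator of `B` has its exponential moment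
controlled by the probability of `B`. -/
theorem lintegral_exp_centered_le_one (π : Measure ℝ) [IsProbabilityMeasure π] {f : ℝ → ℝ}
    (hf : Measurable f) {w l : ℝ} {B : Set ℝ} (hB : MeasurableSet B) (hw : 0 ≤ w) (hl : 0 ≤ l)
    (hlw : 2 * l * w ≤ 1) (hfB : ∀ y, |f y| ≤ w * B.indicator 1 y) :
    ∫⁻ y, ENNReal.ofReal (Real.exp (l * (f y - ∫ y', f y' ∂π) - l ^ 2 * (w ^ 2 * π.real B))) ∂π
      ≤ 1 := by
  have hind : ∀ y, B.indicator (1 : ℝ → ℝ) y ≤ 1 := fun y =>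
    Set.indicator_le_self' (fun _ _ => zero_le_one) y
  have hfw : ∀ y, |f y| ≤ w := fun y => (hfB y).trans (mul_le_of_le_one_right hw (hind y))
  have hfi : Integrable f π := Integrable.of_bound hf.aestronglyMeasurable w (.of_forall hfw)
  set m := ∫ y', f y' ∂π with hm
  have hmw : |m| ≤ w := by
    have := norm_integral_le_of_norm_le_const (μ := π) (f := f) (C := w) (.of_forall hfw)
    simpa using this
  have hf2i : Integrable (fun y => f y ^ 2) π := by
    refine Integrable.of_bound (hf.pow_const 2).aestronglyMeasurable (w ^ 2) (.of_forall fun y => ?_)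
    rw [Real.norm_eq_abs, abs_pow]
    exact pow_le_pow_left₀ (abs_nonneg _) (hfw y) 2
  have hf2 : ∫ y, f y ^ 2 ∂π ≤ w ^ 2 * π.real B := by
    have h1 : ∫ y, w ^ 2 * B.indicator (1 : ℝ → ℝ) y ∂π = w ^ 2 * π.real B := by
      rw [integral_const_mul, integral_indicator_one hB]
    rw [← h1]
    refine integral_mono hf2i (((integrable_const 1).indicator hB).const_mul _) fun y => ?_
    have := hfB y
    by_cases hy : y ∈ B
    · simp only [hy, Set.indicator_of_mem, Pi.one_apply, mul_one] at this ⊢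
      rw [← sq_abs]
      exact pow_le_pow_left₀ (abs_nonneg _) this 2
    · simp only [hy, not_false_eq_true, Set.indicator_of_notMem, mul_zero, abs_nonpos_iff] at this ⊢
      simp [this]
  -- Since |f - m| ≤ 2w, the condition 2lw ≤ 1 puts the exponent in [-1, 1], where eˣ ≤ 1 + x + x².
  have hbound : ∀ y, Real.exp (l * (f y - m)) ≤ 1 + l * (f y - m) + l ^ 2 * (f y - m) ^ 2 := by
    intro y
    have h1 : |l * (f y - m)| ≤ 1 := by
      rw [abs_mul, abs_of_nonneg hl]
      have : |f y - m| ≤ 2 * w := (abs_sub _ _).trans (by linarith [hfw y])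
      nlinarith
    have := (abs_le.1 (Real.abs_exp_sub_one_sub_id_le h1)).2
    nlinarith
  have hgi : Integrable (fun y => 1 + l * (f y - m) + l ^ 2 * (f y - m) ^ 2) π := by
    have h2 : Integrable (fun y => (f y - m) ^ 2) π := by
      have : (fun y => (f y - m) ^ 2) = fun y => f y ^ 2 - 2 * m * f y + m ^ 2 := by
        ext y; ring
      rw [this]
      exact (hf2i.sub (hfi.const_mul _)).add (integrable_const _)
    exact ((integrable_const _).add ((hfi.sub (integrable_const _)).const_mul _)).add
      (h2.const_mul _)
  have hint : ∫ y, (1 + l * (f y - m) + l ^ 2 * (f y - m) ^ 2) ∂π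
      = 1 + l ^ 2 * (∫ y, f y ^ 2 ∂π - m ^ 2) := by
    have : (fun y => 1 + l * (f y - m) + l ^ 2 * (f y - m) ^ 2) =
        fun y => (l ^ 2 * f y ^ 2 + (l - 2 * l ^ 2 * m) * f y) + (1 - l * m + l ^ 2 * m ^ 2) := by
      ext y; ring
    have hi1 := hf2i.const_mul (l ^ 2)
    have hi2 := hfi.const_mul (l - 2 * l ^ 2 * m)
    have hi3 : Integrable (fun y => l ^ 2 * f y ^ 2 + (l - 2 * l ^ 2 * m) * f y) π := hi1.add hi2
    rw [this, integral_add hi3 (integrable_const _), integral_add hi1 hi2, integral_const_mul,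
      integral_const_mul, ← hm]
    simp only [integral_const, probReal_univ, smul_eq_mul]
    ring
  set c := l ^ 2 * (w ^ 2 * π.real B) with hc
  calc ∫⁻ y, ENNReal.ofReal (Real.exp (l * (f y - m) - c)) ∂π
      ≤ ∫⁻ y, ENNReal.ofReal (Real.exp (-c)) *
          ENNReal.ofReal (1 + l * (f y - m) + l ^ 2 * (f y - m) ^ 2) ∂π := by
        refine lintegral_mono fun y => ?_
        rw [← ENNReal.ofReal_mul (Real.exp_pos _).le, sub_eq_add_neg, Real.exp_add, mul_comm]
        gcongr
        exact hbound y
    _ = ENNReal.ofReal (Real.exp (-c) * (1 + l ^ 2 * (∫ y, f y ^ 2 ∂π - m ^ 2))) := by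
        rw [lintegral_const_mul _ (by fun_prop), ENNReal.ofReal_mul (Real.exp_pos _).le, ← hint,
          ofReal_integral_eq_lintegral_ofReal hgi
            (.of_forall fun y => (Real.exp_pos _).le.trans (hbound y))]
    _ ≤ ENNReal.ofReal (Real.exp (-c) * Real.exp c) := by
        gcongr
        refine le_trans ?_ (Real.add_one_le_exp c)
        have : l ^ 2 * (∫ y, f y ^ 2 ∂π - m ^ 2) ≤ c := by
          rw [hc]; gcongr; nlinarith [sq_nonneg m]
        linarith
    _ = 1 := by rw [← Real.exp_add]; simp

variable {Ω X : Type*} [MeasurableSpace Ω] [MeasurableSpace X]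

/-- Exponential supermartingale bound for an adapted sequence whose state `H` is recovered
backwards in time by `T`. -/
theorem lintegral_exp_sum_le_one (μ : Measure Ω) [IsProbabilityMeasure μ] {H : ℕ → Ω → X}
    (hH : ∀ i, Measurable (H i)) {T : X → X} (hT : Measurable T) {g : X → ℝ} (hg : Measurable g)
    (hTH : ∀ i ω, T (H (i + 1) ω) = H i ω) (κ : Kernel X ℝ) [IsMarkovKernel κ]
    (hκ : ∀ i, μ.map (fun ω => (H i ω, g (H (i + 1) ω))) = μ.map (H i) ⊗ₘ κ)
    {F : ℕ → X → ℝ → ℝ} (hF : ∀ i, Measurable (Function.uncurry (F i))) (m : ℕ)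
    (hF1 : ∀ i < m, ∀ h, ∫⁻ y, ENNReal.ofReal (Real.exp (F i h y)) ∂κ h ≤ 1) :
    ∫⁻ ω, ENNReal.ofReal
      (Real.exp (∑ j ∈ Finset.range m, F j (H j ω) (g (H (j + 1) ω)))) ∂μ ≤ 1 := by
  -- As `T` recovers all earlier states, the partial sum is a function of the current state alone.
  -- The joint law of the state and the next output then suffices for conditioning, and no
  -- filtration is needed.
  have hs : ∀ m, ∃ s : X → ℝ, Measurable s ∧
      ∀ ω, ∑ j ∈ Finset.range m, F j (H j ω) (g (H (j + 1) ω)) = s (H m ω) := by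
    intro m
    induction m with
    | zero => exact ⟨fun _ => 0, measurable_const, fun ω => by simp⟩
    | succ m ih =>
      obtain ⟨s, hs, hsω⟩ := ih
      refine ⟨fun h => s (T h) + F m (T h) (g h),
        (hs.comp hT).add ((hF m).comp (hT.prodMk hg)), fun ω => ?_⟩
      simp only [Finset.sum_range_succ, hsω, hTH]
  induction m with
  | zero => simp
  | succ m ih =>
    obtain ⟨s, hs, hsω⟩ := hs m
    have hmeas : Measurable fun q : X × ℝ => ENNReal.ofReal (Real.exp (s q.1 + F m q.1 q.2)) :=
      ((Real.measurable_exp.comp ((hs.comp measurable_fst).add (hF m)))).ennreal_ofReal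
    calc ∫⁻ ω, ENNReal.ofReal
          (Real.exp (∑ j ∈ Finset.range (m + 1), F j (H j ω) (g (H (j + 1) ω)))) ∂μ
        = ∫⁻ ω, (fun q : X × ℝ => ENNReal.ofReal (Real.exp (s q.1 + F m q.1 q.2)))
            (H m ω, g (H (m + 1) ω)) ∂μ := by
          simp_rw [Finset.sum_range_succ, hsω]
      _ = ∫⁻ ω, ENNReal.ofReal (Real.exp (s (H m ω))) *
            ∫⁻ y, ENNReal.ofReal (Real.exp (F m (H m ω) y)) ∂κ (H m ω) ∂μ := by
          have hpair : Measurable fun ω => (H m ω, g (H (m + 1) ω)) :=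
            (hH m).prodMk (hg.comp (hH (m + 1)))
          rw [← lintegral_map hmeas hpair, hκ, Measure.lintegral_compProd hmeas, lintegral_map _ (hH m)]
          · refine lintegral_congr fun ω => ?_
            rw [← lintegral_const_mul]
            · simp_rw [Real.exp_add, ENNReal.ofReal_mul (Real.exp_pos _).le]
            · exact (Real.measurable_exp.comp
                ((hF m).comp measurable_prodMk_left)).ennreal_ofReal
          · exact hmeas.lintegral_kernel_prod_right'
      _ ≤ ∫⁻ ω, ENNReal.ofReal (Real.exp (s (H m ω))) ∂μ :=
          lintegral_mono fun ω => mul_le_of_le_one_right' (hF1 m m.lt_succ_self _)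
      _ ≤ 1 := by simpa only [hsω] using ih fun i hi => hF1 i (hi.trans m.lt_succ_self)

/-- Freedman-type inequality for sums of centred dominated functions of the outputs. -/
theorem measure_sum_centered_ge_le (μ : Measure Ω) [IsProbabilityMeasure μ] {H : ℕ → Ω → X}
    (hH : ∀ i, Measurable (H i)) {T : X → X} (hT : Measurable T) {g : X → ℝ} (hg : Measurable g)
    (hTH : ∀ i ω, T (H (i + 1) ω) = H i ω) (κ : Kernel X ℝ) [IsMarkovKernel κ]
    (hκ : ∀ i, μ.map (fun ω => (H i ω, g (H (i + 1) ω))) = μ.map (H i) ⊗ₘ κ)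
    {f : ℕ → ℝ → ℝ} (hf : ∀ i, Measurable (f i)) {B : ℕ → Set ℝ} (hB : ∀ i, MeasurableSet (B i))
    {w : ℕ → ℝ} (hw : ∀ i, 0 ≤ w i) {l : ℝ} (hl : 0 ≤ l) (hlw : ∀ i, 2 * l * w i ≤ 1) (m : ℕ)
    (hfB : ∀ i < m, ∀ y, |f i y| ≤ w i * (B i).indicator 1 y) (a v : ℝ) :
    μ {ω | a ≤ ∑ j ∈ Finset.range m, (f j (g (H (j + 1) ω)) - ∫ y, f j y ∂κ (H j ω)) ∧
        ∑ j ∈ Finset.range m, w j ^ 2 * (κ (H j ω)).real (B j) ≤ v}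
      ≤ ENNReal.ofReal (Real.exp (-(l * a) + l ^ 2 * v)) := by
  set F : ℕ → X → ℝ → ℝ := fun j h y =>
    l * (f j y - ∫ y', f j y' ∂κ h) - l ^ 2 * (w j ^ 2 * (κ h).real (B j)) with hFdef
  have hF : ∀ i, Measurable (Function.uncurry (F i)) := by
    intro i
    have h1 : Measurable fun h => ∫ y, f i y ∂κ h :=
      ((hf i).stronglyMeasurable.integral_kernel (κ := κ)).measurable
    have h2 : Measurable fun h => (κ h).real (B i) :=
      (Kernel.measurable_coe κ (hB i)).ennreal_toReal
    have h3 := hf i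
    exact (((h3.comp measurable_snd).sub (h1.comp measurable_fst)).const_mul l).sub
      (((h2.comp measurable_fst).const_mul _).const_mul _)
  have hE := lintegral_exp_sum_le_one μ hH hT hg hTH κ hκ hF m
    (fun i hi h => lintegral_exp_centered_le_one (κ h) (hf i) (hB i) (hw i) hl (hlw i) (hfB i hi))
  have hsplit : ∀ ω, ∑ j ∈ Finset.range m, F j (H j ω) (g (H (j + 1) ω)) =
      l * ∑ j ∈ Finset.range m, (f j (g (H (j + 1) ω)) - ∫ y, f j y ∂κ (H j ω))
        - l ^ 2 * ∑ j ∈ Finset.range m, w j ^ 2 * (κ (H j ω)).real (B j) := fun ω => by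
    rw [Finset.mul_sum, Finset.mul_sum, ← Finset.sum_sub_distrib]
  have hpos : ENNReal.ofReal (Real.exp (l * a - l ^ 2 * v)) ≠ 0 := by
    simp [Real.exp_pos]
  have hmk := meas_ge_le_lintegral_div (μ := μ)
    (f := fun ω => ENNReal.ofReal
      (Real.exp (∑ j ∈ Finset.range m, F j (H j ω) (g (H (j + 1) ω)))))
    (Measurable.aemeasurable (by
      refine (Real.measurable_exp.comp (Finset.measurable_sum _ fun j _ => ?_)).ennreal_ofReal
      exact (hF j).comp ((hH j).prodMk (hg.comp (hH (j + 1)))))) hpos ENNReal.ofReal_ne_top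
  refine (measure_mono ?_).trans (hmk.trans ?_)
  · rintro ω ⟨h1, h2⟩
    simp only [Set.mem_ofPred_eq, hsplit]
    gcongr
  · refine (ENNReal.div_le_div_right hE _).trans (le_of_eq ?_)
    rw [one_div, ← ENNReal.ofReal_inv_of_pos (Real.exp_pos _), ← Real.exp_neg]
    congr 2
    ring

end ExponentialBound

/-! ### Stationarity of the outputs and their common conditional kernel. -/

section Stationarity

variable {Ω E : Type*} [MeasurableSpace Ω] [MeasurableSpace E]

theorem measurable_past {ε : ℤ → Ω → E} (hε : ∀ k, Measurable (ε k)) (i : ℤ) :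
    Measurable (past ε i) :=
  measurable_pi_lambda _ fun _ => hε _

theorem measurable_output {ε : ℤ → Ω → E} (hε : ∀ k, Measurable (ε k)) {G : ℕ → (ℕ → E) → ℝ}
    (hG : ∀ n, Measurable (G n)) (n : ℕ) (i : ℤ) : Measurable (output ε G n i) :=
  (hG n).comp (measurable_past hε i)

/-- Dropping the most recent innovation. -/
def dropLast (h : ℕ → E) : ℕ → E := fun k => h (k + 1)

theorem measurable_dropLast : Measurable (dropLast : (ℕ → E) → ℕ → E) :=
  measurable_pi_lambda _ fun _ => measurable_pi_apply _

theorem dropLast_past {Ω E : Type*} (ε : ℤ → Ω → E) (i : ℤ) (ω : Ω) :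
    dropLast (past ε i ω) = past ε (i - 1) ω := by
  ext k
  simp only [dropLast, past]
  congr 1
  push_cast
  ring

theorem map_past_eq (μ : Measure Ω) [IsProbabilityMeasure μ] {ε : ℤ → Ω → E}
    (hε : ∀ k, Measurable (ε k)) (hind : iIndepFun ε μ)
    (hid : ∀ k, IdentDistrib (ε k) (ε 0) μ μ) (i j : ℤ) :
    μ.map (past ε i) = μ.map (past ε j) := by
  have h : ∀ i : ℤ, μ.map (past ε i) = Measure.infinitePi fun _ : ℕ => μ.map (ε 0) := by
    intro i
    have hinj : Function.Injective fun k : ℕ => i - (k : ℤ) := fun a b hab => by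
      simpa using hab
    have := (hind.precomp hinj).map_fun_eq_infinitePi_map fun k => hε _
    refine this.trans ?_
    congr 1
    ext1 k
    exact (hid _).map_eq
  rw [h, h]

theorem map_past_output_eq (μ : Measure Ω) [IsProbabilityMeasure μ] {ε : ℤ → Ω → E}
    (hε : ∀ k, Measurable (ε k)) (hind : iIndepFun ε μ)
    (hid : ∀ k, IdentDistrib (ε k) (ε 0) μ μ) {G : ℕ → (ℕ → E) → ℝ} (hG : ∀ n, Measurable (G n))
    (n : ℕ) (i j : ℤ) :
    μ.map (fun ω => (past ε (i - 1) ω, output ε G n i ω))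
      = μ.map (fun ω => (past ε (j - 1) ω, output ε G n j ω)) := by
  have h : ∀ i : ℤ, μ.map (fun ω => (past ε (i - 1) ω, output ε G n i ω)) =
      (μ.map (past ε i)).map fun h => (dropLast h, G n h) := by
    intro i
    rw [Measure.map_map (measurable_dropLast.prodMk (hG n)) (measurable_past hε i)]
    congr 1
    ext1 ω
    simp [dropLast_past, output]
  rw [h, h, map_past_eq μ hε hind hid i j]

/-- The kernel giving the conditional law of the next output given the history. -/
noncomputable def outKernel (μ : Measure Ω) [IsFiniteMeasure μ] (ε : ℤ → Ω → E)
    (G : ℕ → (ℕ → E) → ℝ) (n : ℕ) : Kernel (ℕ → E) ℝ :=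
  condDistrib (output ε G n 1) (past ε 0) μ

instance (μ : Measure Ω) [IsFiniteMeasure μ] (ε : ℤ → Ω → E) (G : ℕ → (ℕ → E) → ℝ) (n : ℕ) :
    IsMarkovKernel (outKernel μ ε G n) := by
  unfold outKernel; infer_instance

instance (μ : Measure Ω) [IsFiniteMeasure μ] (ε : ℤ → Ω → E) (G : ℕ → (ℕ → E) → ℝ) (n : ℕ)
    (i : ℤ) (ω : Ω) : IsProbabilityMeasure (condLaw μ ε G n i ω) := by
  unfold condLaw; infer_instance

/-- `condDistrib` is built from the joint law only, so equality of joint laws gives equality of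
kernels everywhere, not merely almost everywhere. -/
theorem condDistrib_congr_map {Ω' β : Type*} [MeasurableSpace Ω'] [MeasurableSpace β]
    (μ : Measure Ω') [IsFiniteMeasure μ] {Y Y' : Ω' → ℝ} {X X' : Ω' → β}
    (h : μ.map (fun a => (X a, Y a)) = μ.map (fun a => (X' a, Y' a))) :
    condDistrib Y X μ = condDistrib Y' X' μ := by
  rw [condDistrib, condDistrib]
  congr 1

/-- One kernel for all times and every sample point: this makes the regular conditional laws at
different indices comparable without exceptional null sets. -/
theorem condLaw_eq (μ : Measure Ω) [IsProbabilityMeasure μ] {ε : ℤ → Ω → E}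
    (hε : ∀ k, Measurable (ε k)) (hind : iIndepFun ε μ)
    (hid : ∀ k, IdentDistrib (ε k) (ε 0) μ μ) {G : ℕ → (ℕ → E) → ℝ} (hG : ∀ n, Measurable (G n))
    (n : ℕ) (i : ℤ) (ω : Ω) :
    condLaw μ ε G n i ω = outKernel μ ε G n (past ε (i - 1) ω) := by
  unfold condLaw outKernel
  have h := map_past_output_eq μ hε hind hid hG n i 1
  rw [sub_self] at h
  rw [condDistrib_congr_map μ h]

theorem measurable_condLaw_real (μ : Measure Ω) [IsFiniteMeasure μ] {ε : ℤ → Ω → E}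
    (hε : ∀ k, Measurable (ε k)) (G : ℕ → (ℕ → E) → ℝ)
    (n : ℕ) (i : ℤ) {B : Set ℝ} (hB : MeasurableSet B) :
    Measurable fun ω => (condLaw μ ε G n i ω).real B :=
  ((Kernel.measurable_coe _ hB).comp (measurable_past hε _)).ennreal_toReal

/-- Freedman-type inequality for the outputs. -/
theorem measure_sum_output_ge_le (μ : Measure Ω) [IsProbabilityMeasure μ] {ε : ℤ → Ω → E}
    (hε : ∀ k, Measurable (ε k)) (hind : iIndepFun ε μ)
    (hid : ∀ k, IdentDistrib (ε k) (ε 0) μ μ) {G : ℕ → (ℕ → E) → ℝ} (hG : ∀ n, Measurable (G n))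
    {f : ℕ → ℝ → ℝ} (hf : ∀ i, Measurable (f i)) {B : ℕ → Set ℝ} (hB : ∀ i, MeasurableSet (B i))
    {w : ℕ → ℝ} (hw : ∀ i, 0 ≤ w i) {l : ℝ} (hl : 0 ≤ l) (hlw : ∀ i, 2 * l * w i ≤ 1) (n : ℕ)
    (hfB : ∀ i ∈ Finset.Icc 1 n, ∀ y, |f i y| ≤ w i * (B i).indicator 1 y) (a v : ℝ) :
    μ {ω | a ≤ ∑ i ∈ Finset.Icc 1 n,
          (f i (output ε G n i ω) - ∫ y, f i y ∂condLaw μ ε G n i ω) ∧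
        ∑ i ∈ Finset.Icc 1 n, w i ^ 2 * (condLaw μ ε G n i ω).real (B i) ≤ v}
      ≤ ENNReal.ofReal (Real.exp (-(l * a) + l ^ 2 * v)) := by
  have hsum : ∀ u : ℕ → ℝ, ∑ i ∈ Finset.Icc 1 n, u i = ∑ j ∈ Finset.range n, u (j + 1) := by
    intro u
    rw [Finset.range_eq_Ico, Finset.sum_Ico_add' u 0 n 1]
    rfl
  have hlaw : ∀ (j : ℕ) ω, condLaw μ ε G n ((j + 1 : ℕ) : ℤ) ω =
      outKernel μ ε G n (past ε (j : ℤ) ω) := fun j ω => by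
    rw [condLaw_eq μ hε hind hid hG]
    congr 2
    push_cast
    ring
  have key := measure_sum_centered_ge_le μ (H := fun j : ℕ => past ε (j : ℤ))
    (fun j => measurable_past hε _) measurable_dropLast (hG n)
    (fun j ω => by rw [dropLast_past]; congr 1; push_cast; ring) (outKernel μ ε G n)
    (fun j => by
      have h := map_past_output_eq μ hε hind hid hG n ((j + 1 : ℕ) : ℤ) 1
      have hj : ((j + 1 : ℕ) : ℤ) - 1 = j := by push_cast; ring
      rw [hj, sub_self] at h
      rw [map_past_eq μ hε hind hid j 0]
      refine h.trans ?_
      exact (compProd_map_condDistrib (measurable_output hε hG n 1).aemeasurable).symm)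
    (fun j => hf (j + 1)) (fun j => hB (j + 1)) (fun j => hw (j + 1)) hl (fun j => hlw (j + 1))
    n (fun j hj => hfB (j + 1) (Finset.mem_Icc.2 ⟨by omega, by omega⟩)) a v
  simpa only [hsum, hlaw, output] using key

theorem lintegral_condLaw (μ : Measure Ω) [IsProbabilityMeasure μ] {ε : ℤ → Ω → E}
    (hε : ∀ k, Measurable (ε k)) {G : ℕ → (ℕ → E) → ℝ} (hG : ∀ n, Measurable (G n))
    (n : ℕ) (i : ℤ) {B : Set ℝ} (hB : MeasurableSet B) :
    ∫⁻ ω, condLaw μ ε G n i ω B ∂μ = μ (output ε G n i ⁻¹' B) := by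
  have hout := measurable_output hε hG n i
  have hp := measurable_past hε (i - 1)
  have h := congrArg (fun ν : Measure ((ℕ → E) × ℝ) => ν (Set.univ ×ˢ B))
    (compProd_map_condDistrib (X := past ε (i - 1)) (μ := μ) hout.aemeasurable)
  rw [Measure.compProd_apply_prod MeasurableSet.univ hB, Measure.restrict_univ,
    lintegral_map (Kernel.measurable_coe _ hB) hp, Measure.map_apply (hp.prodMk hout)
      (MeasurableSet.univ.prod hB)] at h
  refine h.trans ?_
  congr 1
  ext ω
  simp

theorem measure_output_preimage (μ : Measure Ω) [IsProbabilityMeasure μ] {ε : ℤ → Ω → E}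
    (hε : ∀ k, Measurable (ε k)) (hind : iIndepFun ε μ)
    (hid : ∀ k, IdentDistrib (ε k) (ε 0) μ μ) {G : ℕ → (ℕ → E) → ℝ} (hG : ∀ n, Measurable (G n))
    (n : ℕ) (i : ℤ) {a : ℝ} (ha : 0 ≤ a) :
    μ (output ε G n i ⁻¹' Set.Ioc (-a) a) =
      ENNReal.ofReal (margCdf μ ε G n a - margCdf μ ε G n (-a)) := by
  have h0 : μ (output ε G n i ⁻¹' Set.Ioc (-a) a) = μ (output ε G n 0 ⁻¹' Set.Ioc (-a) a) := by
    have h : ∀ i, μ (output ε G n i ⁻¹' Set.Ioc (-a) a) =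
        μ.map (past ε i) (G n ⁻¹' Set.Ioc (-a) a) := fun i => by
      rw [Measure.map_apply (measurable_past hε i) (hG n measurableSet_Ioc)]
      rfl
    rw [h, h, map_past_eq μ hε hind hid i 0]
  have hout := measurable_output hε hG n 0
  have hdiff : output ε G n 0 ⁻¹' Set.Ioc (-a) a =
      {ω | output ε G n 0 ω ≤ a} \ {ω | output ε G n 0 ω ≤ -a} := by
    ext ω
    simp [and_comm]
  have hr : μ.real (output ε G n 0 ⁻¹' Set.Ioc (-a) a) =
      margCdf μ ε G n a - margCdf μ ε G n (-a) := by
    have hsub : {ω | output ε G n 0 ω ≤ -a} ⊆ {ω | output ε G n 0 ω ≤ a} :=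
      fun ω (hω : output ε G n 0 ω ≤ -a) => hω.trans (by linarith)
    rw [hdiff, measureReal_sdiff hsub (measurableSet_le hout measurable_const)]
    rfl
  rw [h0, ← hr, ofReal_measureReal]

end Stationarity

/-! ### The random Lipschitz constant and short intervals. -/

section Lipschitz

variable {Ω E : Type*} [MeasurableSpace Ω] [MeasurableSpace E]

/-- The Lipschitz constant over rational arguments of the tail of a kernel on `[-ε₀, ε₀]`. -/
noncomputable def ratLip (κ : Kernel E ℝ) (ε₀ : ℝ) (h : E) : ℝ≥0∞ :=
  ⨆ (q : ℚ × ℚ) (_ : -ε₀ ≤ q.1 ∧ (q.1 : ℝ) < q.2 ∧ (q.2 : ℝ) ≤ ε₀),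
    ENNReal.ofReal (|(κ h).real (Set.Ioi (q.2 : ℝ)) - (κ h).real (Set.Ioi (q.1 : ℝ))|
      / |(q.2 : ℝ) - q.1|)

/-- Restricting to rational arguments makes the supremum countable, hence measurable, as Markov's
inequality requires. -/
theorem measurable_ratLip (κ : Kernel E ℝ) (ε₀ : ℝ) : Measurable (ratLip κ ε₀) := by
  refine Measurable.iSup fun q => Measurable.iSup fun _ => ?_
  have h1 : ∀ u : ℝ, Measurable fun h => (κ h).real (Set.Ioi u) := fun u =>
    (Kernel.measurable_coe κ measurableSet_Ioi).ennreal_toReal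
  have h2 := (h1 q.2).sub (h1 q.1)
  have h3 : Measurable fun h => |(κ h).real (Set.Ioi (q.2 : ℝ)) - (κ h).real (Set.Ioi (q.1 : ℝ))| :=
    continuous_abs.measurable.comp h2
  exact (h3.div_const _).ennreal_ofReal

theorem kernel_Icc_le_ratLip (κ : Kernel E ℝ) [IsMarkovKernel κ] {ε₀ a b : ℝ} (h : E)
    (ha : -ε₀ < a) (hab : a < b) (hb : b < ε₀) :
    κ h (Set.Icc a b) ≤ ratLip κ ε₀ h * ENNReal.ofReal (2 * (b - a)) := by
  -- The rational endpoints exceed the interval by less than half its length on each side, whence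
  -- the factor 2 in the bound.
  obtain ⟨a', ha'1, ha'2⟩ := exists_rat_btwn (show max (-ε₀) (a - (b - a) / 2) < a from
    max_lt ha (by linarith))
  obtain ⟨b', hb'1, hb'2⟩ := exists_rat_btwn (show b < min ε₀ (b + (b - a) / 2) from
    lt_min hb (by linarith))
  rw [max_lt_iff] at ha'1
  rw [lt_min_iff] at hb'2
  have hd : (0 : ℝ) < b' - a' := by linarith
  have hIoc : (κ h).real (Set.Ioc (a' : ℝ) b') =
      (κ h).real (Set.Ioi (a' : ℝ)) - (κ h).real (Set.Ioi (b' : ℝ)) := by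
    rw [← measureReal_sdiff (Set.Ioi_subset_Ioi (by linarith)) measurableSet_Ioi]
    congr 1
    ext y
    simp
  calc κ h (Set.Icc a b) ≤ κ h (Set.Ioc (a' : ℝ) b') :=
        measure_mono fun y hy => ⟨ha'2.trans_le hy.1, hy.2.trans hb'1.le⟩
    _ = ENNReal.ofReal (|(κ h).real (Set.Ioi (b' : ℝ)) - (κ h).real (Set.Ioi (a' : ℝ))|
          / |(b' : ℝ) - a'|) * ENNReal.ofReal (b' - a') := by
        rw [← ENNReal.ofReal_mul (by positivity), abs_of_pos hd, div_mul_cancel₀ _ hd.ne',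
          abs_sub_comm, ← hIoc, abs_of_nonneg measureReal_nonneg, ofReal_measureReal]
    _ ≤ _ := by
        gcongr
        · exact le_iSup₂_of_le (a', b') ⟨ha'1.1.le, by simpa using hd, hb'2.1.le⟩ le_rfl
        · linarith

/-- Stationarity moves the history to time 0, where the rational supremum lies pointwise below the
full one. Monotonicity of the lower integral needs no measurability of the uncountable supremum. -/
theorem lintegral_ratLip_past_le (μ : Measure Ω) [IsProbabilityMeasure μ] {ε : ℤ → Ω → E}
    (hε : ∀ k, Measurable (ε k)) (hind : iIndepFun ε μ)
    (hid : ∀ k, IdentDistrib (ε k) (ε 0) μ μ) {G : ℕ → (ℕ → E) → ℝ} (hG : ∀ n, Measurable (G n))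
    (n : ℕ) (ε₀ : ℝ) (i : ℤ) :
    ∫⁻ ω, ratLip (outKernel μ ε G n) ε₀ (past ε i ω) ∂μ ≤ ∫⁻ ω, lipConst μ ε G ε₀ n ω ∂μ := by
  rw [← lintegral_map (measurable_ratLip _ _) (measurable_past hε i),
    map_past_eq μ hε hind hid i 0, lintegral_map (measurable_ratLip _ _) (measurable_past hε 0)]
  refine lintegral_mono fun ω => iSup₂_le fun q hq => ?_
  unfold lipConst
  refine le_iSup_of_le (q.1 : ℝ) (le_iSup₂_of_le (q.2 : ℝ) hq ?_)
  simp only [condTail, condLaw_eq μ hε hind hid hG, sub_self]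
  exact le_rfl

end Lipschitz

/-! ### Step functions and the windows on which they vary. -/

section Steps

/-- The increment `1{g y ≤ t} - 1{g y ≤ 0}`. -/
noncomputable def stepDiff (g t y : ℝ) : ℝ :=
  (if g * y ≤ t then 1 else 0) - if g * y ≤ 0 then 1 else 0

/-- The outputs in the window for which the level `t` and a level within `h` of it may be
separated. -/
def oscSet (g a t h : ℝ) : Set ℝ := Set.Ioc (-a) a ∩ {y | |g * y - t| ≤ h}

theorem measurable_stepDiff (g t : ℝ) : Measurable (stepDiff g t) := by
  unfold stepDiff
  refine (Measurable.ite ?_ measurable_const measurable_const).sub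
    (Measurable.ite ?_ measurable_const measurable_const)
  · exact measurableSet_le (by fun_prop) measurable_const
  · exact measurableSet_le (by fun_prop) measurable_const

theorem measurableSet_oscSet (g a t h : ℝ) : MeasurableSet (oscSet g a t h) :=
  measurableSet_Ioc.inter (measurableSet_le (by fun_prop) measurable_const)

theorem psi_sub_psi (α g t y : ℝ) :
    psi α (g * y - t) - psi α (g * y - 0) = -stepDiff g t y := by
  simp only [psi, stepDiff, sub_nonpos]
  ring

theorem mem_window_of_between {c g a y : ℝ} (hc : 0 < c) (hg : c ≤ g) (ha : 0 ≤ a)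
    (h1 : -(c * a) < g * y) (h2 : g * y ≤ c * a) : y ∈ Set.Ioc (-a) a := by
  constructor
  · by_contra! h
    nlinarith [mul_nonneg (sub_nonneg.2 hg) ha]
  · by_contra! h
    nlinarith [mul_nonneg (sub_nonneg.2 hg) ha]

/-- The two steps differ only when `g * y` lies between the levels, hence within `h` of `t'`. Both
levels are at most `c * a` in size and `g ≥ c`, which confines `y` to the window; its left end is
open because `g * y` strictly exceeds the smaller level. -/
theorem abs_stepDiff_sub_le {c g a t t' h : ℝ} (hc : 0 < c) (hg : c ≤ g) (ha : 0 ≤ a)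
    (ht : |t| ≤ c * a) (ht' : |t'| ≤ c * a) (hh : |t - t'| ≤ h) (y : ℝ) :
    |stepDiff g t y - stepDiff g t' y| ≤ (oscSet g a t' h).indicator 1 y := by
  have hnn : (0 : ℝ) ≤ (oscSet g a t' h).indicator 1 y :=
    Set.indicator_nonneg (fun _ _ => zero_le_one) y
  obtain ⟨ht1, ht2⟩ := abs_le.1 ht
  obtain ⟨ht'1, ht'2⟩ := abs_le.1 ht'
  obtain ⟨hh1, hh2⟩ := abs_le.1 hh
  by_cases h1 : g * y ≤ t <;> by_cases h2 : g * y ≤ t'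
  · simpa [stepDiff, h1, h2] using hnn
  · push Not at h2
    have : y ∈ oscSet g a t' h :=
      ⟨mem_window_of_between hc hg ha (by linarith) (by linarith),
        show |g * y - t'| ≤ h from abs_le.2 ⟨by linarith, by linarith⟩⟩
    simp [stepDiff, h1, h2.not_ge, this]
  · push Not at h1
    have : y ∈ oscSet g a t' h :=
      ⟨mem_window_of_between hc hg ha (by linarith) (by linarith),
        show |g * y - t'| ≤ h from abs_le.2 ⟨by linarith, by linarith⟩⟩
    simp only [stepDiff, h1.not_ge, h2, this, Set.indicator_of_mem, if_true, if_false]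
    split_ifs <;> norm_num
  · simpa [stepDiff, h1, h2] using hnn

theorem abs_stepDiff_le {c g a t : ℝ} (hc : 0 < c) (hg : c ≤ g) (ha : 0 ≤ a)
    (ht : |t| ≤ c * a) (y : ℝ) : |stepDiff g t y| ≤ (Set.Ioc (-a) a).indicator 1 y := by
  have h := abs_stepDiff_sub_le hc hg ha ht (t' := 0) (by simpa using by positivity) le_rfl y
  have h0 : stepDiff g 0 y = 0 := by simp [stepDiff]
  rw [h0, sub_zero] at h
  exact h.trans (Set.indicator_le_indicator_of_subset Set.inter_subset_left
    (fun _ => zero_le_one) y)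

theorem oscSet_subset_Icc {g a t h : ℝ} (hg : 0 < g) :
    oscSet g a t h ⊆ Set.Icc ((t - h) / g) ((t + h) / g) := by
  rintro y ⟨-, hy⟩
  have hy' := abs_le.1 (show |g * y - t| ≤ h from hy)
  constructor
  · rw [div_le_iff₀ hg]; linarith
  · rw [le_div_iff₀ hg]; linarith

theorem integrable_of_abs_le_indicator {π : Measure ℝ} [IsProbabilityMeasure π] {f : ℝ → ℝ}
    (hf : Measurable f) {B : Set ℝ} (h : ∀ y, |f y| ≤ B.indicator 1 y) : Integrable f π :=
  Integrable.of_bound hf.aestronglyMeasurable 1 (.of_forall fun y =>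
    (h y).trans (Set.indicator_le_self' (fun _ _ => zero_le_one) y))

theorem abs_centered_le {π : Measure ℝ} [IsProbabilityMeasure π] {f : ℝ → ℝ}
    {B : Set ℝ} (hB : MeasurableSet B) (h : ∀ y, |f y| ≤ B.indicator 1 y)
    (e : ℝ) : |f e - ∫ y, f y ∂π| ≤ B.indicator 1 e + π.real B := by
  refine (abs_sub _ _).trans (add_le_add (h e) ?_)
  rw [← integral_indicator_one hB]
  exact norm_integral_le_of_norm_le (g := B.indicator 1) ((integrable_const 1).indicator hB)
    (.of_forall fun y => (Real.norm_eq_abs (f y)).trans_le (h y))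

end Steps

/-! ### Truncation of the design vectors and the deterministic splitting. -/

section Splitting

variable {p : ℕ}

theorem euclidean_norm_le_sum_abs (v : EuclideanSpace ℝ (Fin p)) : ‖v‖ ≤ ∑ k, |v k| := by
  rw [EuclideanSpace.norm_eq]
  refine Real.sqrt_le_iff.2 ⟨Finset.sum_nonneg fun _ _ => abs_nonneg _, ?_⟩
  simp only [Real.norm_eq_abs]
  exact Finset.sum_sq_le_sq_sum_of_nonneg fun _ _ => abs_nonneg _

/-- The part of a vector kept below the norm level `s`. -/
noncomputable def truncVec (s : ℝ) (v : EuclideanSpace ℝ (Fin p)) : EuclideanSpace ℝ (Fin p) :=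
  if ‖v‖ ≤ s then v else 0

theorem norm_truncVec_le (s : ℝ) (v : EuclideanSpace ℝ (Fin p)) : ‖truncVec s v‖ ≤ ‖v‖ := by
  unfold truncVec
  split_ifs <;> simp

theorem norm_truncVec_le_level {s : ℝ} (hs : 0 ≤ s) (v : EuclideanSpace ℝ (Fin p)) :
    ‖truncVec s v‖ ≤ s := by
  unfold truncVec
  split_ifs with h
  · exact h
  · simpa using hs

/-- Beyond the level `s` one has ‖v‖ ≤ ‖v‖²/s, which turns first-order weights into the quadratic
weights of `rho`. -/
theorem norm_sub_truncVec_le {s : ℝ} (hs : 0 < s) (v : EuclideanSpace ℝ (Fin p)) :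
    ‖v - truncVec s v‖ ≤ s⁻¹ * ‖v‖ ^ 2 := by
  unfold truncVec
  split_ifs with h
  · simp; positivity
  · push Not at h
    rw [sub_zero, inv_mul_eq_div, le_div_iff₀ hs]
    nlinarith [norm_nonneg v]

/-- Splitting of the centred sum at level `φ` into the contribution of large vectors, the
centred sum at a neighbouring level `φ'` and the oscillation between the two levels. -/
theorem norm_sum_centered_stepDiff_le (S : Finset ℕ) (e : ℕ → ℝ) (π : ℕ → Measure ℝ)
    [∀ i, IsProbabilityMeasure (π i)] {γ : ℕ → ℝ} {c δ h : ℝ} (s : ℝ) (hc : 0 < c) (hδ : 0 ≤ δ)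
    (hγ : ∀ i ∈ S, c ≤ γ i) (z : ℕ → EuclideanSpace ℝ (Fin p))
    {φ φ' : EuclideanSpace ℝ (Fin p)} (hφ : ‖φ‖ ≤ δ) (hφ' : ‖φ'‖ ≤ δ) (hd : ‖φ - φ'‖ ≤ h) :
    ‖∑ i ∈ S, (stepDiff (γ i) (inner ℝ (z i) φ) (e i)
        - ∫ y, stepDiff (γ i) (inner ℝ (z i) φ) y ∂π i) • z i‖
      ≤ ∑ i ∈ S, ‖z i - truncVec s (z i)‖ *
          ((Set.Ioc (-(c⁻¹ * ‖z i‖ * δ)) (c⁻¹ * ‖z i‖ * δ)).indicator 1 (e i)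
            + (π i).real (Set.Ioc (-(c⁻¹ * ‖z i‖ * δ)) (c⁻¹ * ‖z i‖ * δ)))
        + ∑ k, |∑ i ∈ S, (truncVec s (z i) k * stepDiff (γ i) (inner ℝ (z i) φ') (e i)
            - ∫ y, truncVec s (z i) k * stepDiff (γ i) (inner ℝ (z i) φ') y ∂π i)|
        + ∑ i ∈ S, (‖truncVec s (z i)‖ *
              (oscSet (γ i) (c⁻¹ * ‖z i‖ * δ) (inner ℝ (z i) φ') (‖z i‖ * h)).indicator 1 (e i)
            - ∫ y, ‖truncVec s (z i)‖ *
              (oscSet (γ i) (c⁻¹ * ‖z i‖ * δ) (inner ℝ (z i) φ') (‖z i‖ * h)).indicator 1 y ∂π i)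
        + 2 * ∑ i ∈ S, ‖truncVec s (z i)‖ *
            (π i).real (oscSet (γ i) (c⁻¹ * ‖z i‖ * δ) (inner ℝ (z i) φ') (‖z i‖ * h)) := by
  have hca : ∀ i, c * (c⁻¹ * ‖z i‖ * δ) = ‖z i‖ * δ := fun i => by field_simp
  have hinner : ∀ i, ∀ ϑ : EuclideanSpace ℝ (Fin p), ‖ϑ‖ ≤ δ →
      |inner ℝ (z i) ϑ| ≤ c * (c⁻¹ * ‖z i‖ * δ) := fun i ϑ hϑ => by
    rw [hca]
    exact (abs_real_inner_le_norm _ _).trans (by gcongr)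
  have ha : ∀ i, 0 ≤ c⁻¹ * ‖z i‖ * δ := fun i => by positivity
  have hsplit : ∑ i ∈ S, (stepDiff (γ i) (inner ℝ (z i) φ) (e i)
        - ∫ y, stepDiff (γ i) (inner ℝ (z i) φ) y ∂π i) • z i
      = ∑ i ∈ S, (stepDiff (γ i) (inner ℝ (z i) φ) (e i)
          - ∫ y, stepDiff (γ i) (inner ℝ (z i) φ) y ∂π i) • (z i - truncVec s (z i))
        + ∑ i ∈ S, (stepDiff (γ i) (inner ℝ (z i) φ') (e i)
          - ∫ y, stepDiff (γ i) (inner ℝ (z i) φ') y ∂π i) • truncVec s (z i)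
        + ∑ i ∈ S, ((stepDiff (γ i) (inner ℝ (z i) φ) (e i)
          - ∫ y, stepDiff (γ i) (inner ℝ (z i) φ) y ∂π i)
          - (stepDiff (γ i) (inner ℝ (z i) φ') (e i)
          - ∫ y, stepDiff (γ i) (inner ℝ (z i) φ') y ∂π i)) • truncVec s (z i) := by
    rw [← Finset.sum_add_distrib, ← Finset.sum_add_distrib]
    refine Finset.sum_congr rfl fun i _ => ?_
    module
  have hlarge : ‖∑ i ∈ S, (stepDiff (γ i) (inner ℝ (z i) φ) (e i)
          - ∫ y, stepDiff (γ i) (inner ℝ (z i) φ) y ∂π i) • (z i - truncVec s (z i))‖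
      ≤ ∑ i ∈ S, ‖z i - truncVec s (z i)‖ *
          ((Set.Ioc (-(c⁻¹ * ‖z i‖ * δ)) (c⁻¹ * ‖z i‖ * δ)).indicator 1 (e i)
            + (π i).real (Set.Ioc (-(c⁻¹ * ‖z i‖ * δ)) (c⁻¹ * ‖z i‖ * δ))) := by
    refine (norm_sum_le _ _).trans (Finset.sum_le_sum fun i hi => ?_)
    rw [norm_smul, mul_comm, Real.norm_eq_abs]
    gcongr
    exact abs_centered_le measurableSet_Ioc
      (abs_stepDiff_le hc (hγ i hi) (ha i) (hinner i φ hφ)) (e i)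
  have hgrid : ‖∑ i ∈ S, (stepDiff (γ i) (inner ℝ (z i) φ') (e i)
          - ∫ y, stepDiff (γ i) (inner ℝ (z i) φ') y ∂π i) • truncVec s (z i)‖
      ≤ ∑ k, |∑ i ∈ S, (truncVec s (z i) k * stepDiff (γ i) (inner ℝ (z i) φ') (e i)
            - ∫ y, truncVec s (z i) k * stepDiff (γ i) (inner ℝ (z i) φ') y ∂π i)| := by
    refine (euclidean_norm_le_sum_abs _).trans (le_of_eq (Finset.sum_congr rfl fun k _ => ?_))
    congr 1
    rw [WithLp.ofLp_sum, Finset.sum_apply]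
    refine Finset.sum_congr rfl fun i _ => ?_
    rw [integral_const_mul, PiLp.smul_apply, smul_eq_mul]
    ring
  -- A centred increment is at most indicator plus conditional probability, which equals the centred
  -- indicator plus twice that probability; this is the origin of the factor 2.
  have hosc : ‖∑ i ∈ S, ((stepDiff (γ i) (inner ℝ (z i) φ) (e i)
          - ∫ y, stepDiff (γ i) (inner ℝ (z i) φ) y ∂π i)
          - (stepDiff (γ i) (inner ℝ (z i) φ') (e i)
          - ∫ y, stepDiff (γ i) (inner ℝ (z i) φ') y ∂π i)) • truncVec s (z i)‖
      ≤ ∑ i ∈ S, (‖truncVec s (z i)‖ *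
              (oscSet (γ i) (c⁻¹ * ‖z i‖ * δ) (inner ℝ (z i) φ') (‖z i‖ * h)).indicator 1 (e i)
            - ∫ y, ‖truncVec s (z i)‖ *
              (oscSet (γ i) (c⁻¹ * ‖z i‖ * δ) (inner ℝ (z i) φ') (‖z i‖ * h)).indicator 1 y ∂π i)
        + 2 * ∑ i ∈ S, ‖truncVec s (z i)‖ *
            (π i).real (oscSet (γ i) (c⁻¹ * ‖z i‖ * δ) (inner ℝ (z i) φ') (‖z i‖ * h)) := by
    rw [Finset.mul_sum, ← Finset.sum_add_distrib]
    refine (norm_sum_le _ _).trans (Finset.sum_le_sum fun i hi => ?_)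
    have hmO := measurableSet_oscSet (γ i) (c⁻¹ * ‖z i‖ * δ) (inner ℝ (z i) φ') (‖z i‖ * h)
    have hD := abs_stepDiff_sub_le hc (hγ i hi) (ha i) (hinner i φ hφ) (hinner i φ' hφ')
      (h := ‖z i‖ * h) (by
        rw [← inner_sub_right]
        exact (abs_real_inner_le_norm _ _).trans (by gcongr))
    have hi1 : Integrable (stepDiff (γ i) (inner ℝ (z i) φ)) (π i) :=
      integrable_of_abs_le_indicator (measurable_stepDiff _ _)
        (abs_stepDiff_le hc (hγ i hi) (ha i) (hinner i φ hφ))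
    have hi2 : Integrable (stepDiff (γ i) (inner ℝ (z i) φ')) (π i) :=
      integrable_of_abs_le_indicator (measurable_stepDiff _ _)
        (abs_stepDiff_le hc (hγ i hi) (ha i) (hinner i φ' hφ'))
    have hcen := abs_centered_le (π := π i) hmO hD (e i)
    rw [integral_sub hi1 hi2] at hcen
    rw [norm_smul, mul_comm, Real.norm_eq_abs, integral_const_mul, integral_indicator_one hmO]
    have hmul := mul_le_mul_of_nonneg_left hcen (norm_nonneg (truncVec s (z i)))
    refine le_trans (le_of_eq ?_) (hmul.trans (le_of_eq ?_))
    · congr 2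
      ring
    · ring
  rw [hsplit]
  refine (norm_add₃_le).trans ?_
  linarith

end Splitting

/-! ### Markov's inequality for weighted sums. -/

section Markov

variable {Ω : Type*} [MeasurableSpace Ω]

/-- Markov's inequality for a weighted sum. -/
theorem measure_lt_weighted_sum_le (μ : Measure Ω) (S : Finset ℕ) {c m : ℕ → ℝ}
    {Y : ℕ → Ω → ℝ≥0∞} (hc : ∀ i ∈ S, 0 ≤ c i) (hm : ∀ i ∈ S, 0 ≤ m i)
    (hY : ∀ i ∈ S, Measurable (Y i)) (hYm : ∀ i ∈ S, ∫⁻ ω, Y i ω ∂μ ≤ ENNReal.ofReal (m i))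
    {D K : ℝ} (hD : 0 < D) (hK : 0 < K) (hcm : ∑ i ∈ S, c i * m i ≤ D) :
    μ {ω | ENNReal.ofReal (K * D) < ∑ i ∈ S, ENNReal.ofReal (c i) * Y i ω}
      ≤ ENNReal.ofReal K⁻¹ := by
  have hint : ∫⁻ ω, ∑ i ∈ S, ENNReal.ofReal (c i) * Y i ω ∂μ ≤ ENNReal.ofReal D := by
    rw [lintegral_finsetSum _ fun i hi => (hY i hi).const_mul _]
    calc ∑ i ∈ S, ∫⁻ ω, ENNReal.ofReal (c i) * Y i ω ∂μ
        ≤ ∑ i ∈ S, ENNReal.ofReal (c i * m i) := by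
          refine Finset.sum_le_sum fun i hi => ?_
          rw [lintegral_const_mul _ (hY i hi), ENNReal.ofReal_mul (hc i hi)]
          gcongr
          exact hYm i hi
      _ = ENNReal.ofReal (∑ i ∈ S, c i * m i) :=
          (ENNReal.ofReal_sum_of_nonneg fun i hi => mul_nonneg (hc i hi) (hm i hi)).symm
      _ ≤ _ := ENNReal.ofReal_le_ofReal hcm
  have hKD : 0 < K * D := by positivity
  refine (measure_mono (t := {ω | ENNReal.ofReal (K * D) ≤ ∑ i ∈ S, ENNReal.ofReal (c i) * Y i ω})
    fun ω hω => le_of_lt (Set.mem_ofPred_eq ▸ hω)).trans ((meas_ge_le_lintegral_div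
    (Finset.measurable_fun_sum _ fun i hi => (hY i hi).const_mul _).aemeasurable
    (by simpa using hKD) ENNReal.ofReal_ne_top).trans ?_)
  refine (ENNReal.div_le_div_right hint _).trans (le_of_eq ?_)
  rw [← ENNReal.ofReal_div_of_pos hKD]
  congr 1
  field_simp

theorem measure_lt_weighted_sum_real_le (μ : Measure Ω) (S : Finset ℕ) {c m : ℕ → ℝ}
    {Y : ℕ → Ω → ℝ} (hc : ∀ i ∈ S, 0 ≤ c i) (hm : ∀ i ∈ S, 0 ≤ m i)
    (hY : ∀ i ∈ S, Measurable (Y i)) (hY0 : ∀ i ∈ S, ∀ ω, 0 ≤ Y i ω)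
    (hYm : ∀ i ∈ S, ∫⁻ ω, ENNReal.ofReal (Y i ω) ∂μ ≤ ENNReal.ofReal (m i))
    {D K : ℝ} (hD : 0 < D) (hK : 0 < K) (hcm : ∑ i ∈ S, c i * m i ≤ D) :
    μ {ω | K * D < ∑ i ∈ S, c i * Y i ω} ≤ ENNReal.ofReal K⁻¹ := by
  refine (measure_mono ?_).trans (measure_lt_weighted_sum_le μ S hc hm
    (fun i hi => (hY i hi).ennreal_ofReal) hYm hD hK hcm)
  intro ω hω
  have hω' : K * D < ∑ i ∈ S, c i * Y i ω := hω
  have hpos : 0 < K * D := by positivity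
  have := (ENNReal.ofReal_lt_ofReal_iff (hpos.trans hω')).2 hω'
  rw [ENNReal.ofReal_sum_of_nonneg fun i hi => mul_nonneg (hc i hi) (hY0 i hi ω)] at this
  refine this.trans_le (le_of_eq (Finset.sum_congr rfl fun i hi => ?_))
  rw [ENNReal.ofReal_mul (hc i hi)]

end Markov

/-! ### The tail bound for a fixed sample size and a fixed net. -/

section FixedSample

variable {Ω E : Type*} [MeasurableSpace Ω] [MeasurableSpace E] {p : ℕ}

theorem margCdf_mono {E : Type*} (μ : Measure Ω) [IsFiniteMeasure μ] (ε : ℤ → Ω → E)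
    (G : ℕ → (ℕ → E) → ℝ) (n : ℕ) : Monotone (margCdf μ ε G n) := fun u v huv =>
  measureReal_mono fun ω (hω : output ε G n 0 ω ≤ u) => hω.trans huv

theorem integrable_psi (π : Measure ℝ) [IsProbabilityMeasure π] (α g t : ℝ) :
    Integrable (fun y => psi α (g * y - t)) π := by
  refine Integrable.of_bound (C := |1 - α| + 1) (Measurable.aestronglyMeasurable ?_)
    (.of_forall fun y => ?_)
  · unfold psi
    refine measurable_const.sub (Measurable.ite ?_ measurable_const measurable_const)
    exact measurableSet_le (by fun_prop) measurable_const
  · simp only [psi, Real.norm_eq_abs]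
    split_ifs
    · exact (abs_sub _ _).trans (by simp)
    · simp

theorem martPart_sub_martPart_zero (μ : Measure Ω) [IsProbabilityMeasure μ] (ε : ℤ → Ω → E)
    (G : ℕ → (ℕ → E) → ℝ) (α : ℕ → ℝ) (γ : ℕ → ℕ → ℝ) (z : ℕ → ℕ → EuclideanSpace ℝ (Fin p))
    (n : ℕ) (φ : EuclideanSpace ℝ (Fin p)) (ω : Ω) :
    martPart μ ε G α γ z n φ ω - martPart μ ε G α γ z n 0 ω =
      -∑ i ∈ Finset.Icc 1 n, (stepDiff (γ n i) (inner ℝ (z n i) φ) (output ε G n i ω)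
        - ∫ y, stepDiff (γ n i) (inner ℝ (z n i) φ) y ∂condLaw μ ε G n i ω) • z n i := by
  unfold martPart
  rw [← Finset.sum_sub_distrib, ← Finset.sum_neg_distrib]
  refine Finset.sum_congr rfl fun i _ => ?_
  have hint : ∫ y, stepDiff (γ n i) (inner ℝ (z n i) φ) y ∂condLaw μ ε G n i ω =
      ∫ y, psi (α n) (γ n i * y - 0) ∂condLaw μ ε G n i ω
        - ∫ y, psi (α n) (γ n i * y - inner ℝ (z n i) φ) ∂condLaw μ ε G n i ω := by
    rw [← integral_sub (integrable_psi _ _ _ _) (integrable_psi _ _ _ _)]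
    refine integral_congr_ae (.of_forall fun y => ?_)
    have := psi_sub_psi (α n) (γ n i) (inner ℝ (z n i) φ) y
    simp only
    linarith
  have hstep := psi_sub_psi (α n) (γ n i) (inner ℝ (z n i) φ) (output ε G n i ω)
  have hstep' : stepDiff (γ n i) (inner ℝ (z n i) φ) (output ε G n i ω) =
      psi (α n) (γ n i * output ε G n i ω - 0)
        - psi (α n) (γ n i * output ε G n i ω - inner ℝ (z n i) φ) := by linarith
  rw [hint, hstep', inner_zero_right]
  module

/-- A bound on the tail of the supremum of the increments of the martingale part, for a fixed
sample size and a fixed finite net `P` of the ball of radius `δ`. -/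
theorem measure_sup_martPart_le (μ : Measure Ω) [IsProbabilityMeasure μ] {ε : ℤ → Ω → E}
    (hε : ∀ k, Measurable (ε k)) (hind : iIndepFun ε μ)
    (hid : ∀ k, IdentDistrib (ε k) (ε 0) μ μ) {G : ℕ → (ℕ → E) → ℝ} (hG : ∀ n, Measurable (G n))
    (α : ℕ → ℝ) (γ : ℕ → ℕ → ℝ) (z : ℕ → ℕ → EuclideanSpace ℝ (Fin p)) (n : ℕ)
    {c ε₀ δ h s K D : ℝ} (a : ℝ) (hc : 0 < c) (hδ : 0 < δ) (hh : 0 < h) (hs : 0 < s) (hK : 0 < K)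
    (hD : 0 < D) (hγ : ∀ i ∈ Finset.Icc 1 n, c ≤ γ n i) (hρ : rho μ ε G c z n δ ≤ s ^ 2)
    {L : ℝ≥0} (hL : ∫⁻ ω, lipConst μ ε G ε₀ n ω ∂μ ≤ L)
    (hwin : ∀ i ∈ Finset.Icc 1 n, ‖z n i‖ * (δ + h) < c * ε₀)
    (hDsum : ∑ i ∈ Finset.Icc 1 n, 4 * h / c * ‖z n i‖ ^ 2 * L ≤ D)
    (P : Finset (EuclideanSpace ℝ (Fin p))) (hP : ∀ φ ∈ P, ‖φ‖ ≤ δ)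
    (hcov : ∀ φ : EuclideanSpace ℝ (Fin p), ‖φ‖ ≤ δ → ∃ φ' ∈ P, ‖φ - φ'‖ ≤ h) :
    μ {ω | ENNReal.ofReal (K * (2 * s) + p * a + a + 2 * (K * D)) <
        ⨆ φ ∈ Metric.closedBall (0 : EuclideanSpace ℝ (Fin p)) δ,
          ‖martPart μ ε G α γ z n φ ω - martPart μ ε G α γ z n 0 ω‖ₑ}
      ≤ ENNReal.ofReal K⁻¹ + ENNReal.ofReal K⁻¹ + ENNReal.ofReal K⁻¹
        + P.card * ((2 * p + 1) * ENNReal.ofReal (Real.exp (-(a / (2 * s)) + K / 4))) := by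
  set S := Finset.Icc 1 n
  set w : ℕ → ℝ := fun i => c⁻¹ * ‖z n i‖ * δ with hw
  set B : ℕ → Set ℝ := fun i => Set.Ioc (-w i) (w i) with hB
  have hBm : ∀ i, MeasurableSet (B i) := fun i => measurableSet_Ioc
  have hw0 : ∀ i, 0 ≤ w i := fun i => by simp only [hw]; positivity
  set ζ : ℕ → EuclideanSpace ℝ (Fin p) := fun i => truncVec s (z n i) with hζ
  set ΔF : ℕ → ℝ := fun i => margCdf μ ε G n (w i) - margCdf μ ε G n (-w i) with hΔF
  have hΔF0 : ∀ i, 0 ≤ ΔF i := fun i =>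
    sub_nonneg.2 (margCdf_mono μ ε G n (by linarith [hw0 i]))
  have hρ' : ∑ i ∈ S, ‖z n i‖ ^ 2 * ΔF i ≤ s ^ 2 := hρ
  set π : ℕ → Ω → Measure ℝ := fun i ω => condLaw μ ε G n i ω with hπ
  set e : ℕ → Ω → ℝ := fun i ω => output ε G n i ω with he
  have hem : ∀ i, Measurable (e i) := fun i => measurable_output hε hG n i
  have hπm : ∀ i, Measurable fun ω => (π i ω).real (B i) := fun i =>
    measurable_condLaw_real μ hε G n i (hBm i)
  have hEπ : ∀ i, ∫⁻ ω, ENNReal.ofReal ((π i ω).real (B i)) ∂μ = ENNReal.ofReal (ΔF i) := by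
    intro i
    rw [← measure_output_preimage μ hε hind hid hG n i (hw0 i),
      ← lintegral_condLaw μ hε hG n i (hBm i)]
    exact lintegral_congr fun ω => ofReal_measureReal
  have hEind : ∀ i, ∫⁻ ω, ENNReal.ofReal ((B i).indicator 1 (e i ω)) ∂μ = ENNReal.ofReal (ΔF i) := by
    intro i
    rw [← measure_output_preimage μ hε hind hid hG n i (hw0 i),
      ← lintegral_indicator_one (hem i (hBm i))]
    refine lintegral_congr fun ω => ?_
    by_cases hω : e i ω ∈ B i
    · simp [hω]
    · simp [hω]
  set O : EuclideanSpace ℝ (Fin p) → ℕ → Set ℝ := fun φ' i =>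
    oscSet (γ n i) (w i) (inner ℝ (z n i) φ') (‖z n i‖ * h) with hO
  -- the exceptional events
  set E₁ : Set Ω := {ω | K * (2 * s) < ∑ i ∈ S, ‖z n i - ζ i‖ *
    ((B i).indicator 1 (e i ω) + (π i ω).real (B i))} with hE₁
  set V : Ω → ℝ := fun ω => ∑ i ∈ S, ‖ζ i‖ ^ 2 * (π i ω).real (B i) with hV
  set E₂ : Set Ω := {ω | K * s ^ 2 < V ω} with hE₂
  set E₃ : Set Ω := {ω | ENNReal.ofReal (K * D) < ∑ i ∈ S, ENNReal.ofReal (4 * h / c * ‖z n i‖ ^ 2) *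
    ratLip (outKernel μ ε G n) ε₀ (past ε (i - 1) ω)} with hE₃
  set Q : (ℕ → ℝ → ℝ) → Set Ω := fun f =>
    {ω | a ≤ ∑ i ∈ S, (f i (e i ω) - ∫ y, f i y ∂π i ω) ∧ V ω ≤ K * s ^ 2} with hQ
  -- The sign `σ = ±1` lets the one-sided Freedman bound control absolute values, coordinate by
  -- coordinate.
  set fg : EuclideanSpace ℝ (Fin p) → Fin p → ℝ → ℕ → ℝ → ℝ := fun φ' k σ i y =>
    σ * (ζ i k * stepDiff (γ n i) (inner ℝ (z n i) φ') y) with hfg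
  set fo : EuclideanSpace ℝ (Fin p) → ℕ → ℝ → ℝ := fun φ' i y =>
    ‖ζ i‖ * (O φ' i).indicator 1 y with hfo
  have hμ₁ : μ E₁ ≤ ENNReal.ofReal K⁻¹ := by
    refine measure_lt_weighted_sum_real_le μ S (m := fun i => 2 * ΔF i)
      (fun i _ => norm_nonneg _) (fun i _ => mul_nonneg zero_le_two (hΔF0 i))
      (fun i _ => ?_) (fun i _ ω => ?_) (fun i _ => ?_) (by positivity) hK ?_
    · exact ((measurable_one.indicator (hBm i)).comp (hem i)).add (hπm i)
    · exact add_nonneg (Set.indicator_nonneg (fun _ _ => zero_le_one) _) measureReal_nonneg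
    · have : ∀ ω, ENNReal.ofReal ((B i).indicator 1 (e i ω) + (π i ω).real (B i)) =
          ENNReal.ofReal ((B i).indicator 1 (e i ω)) + ENNReal.ofReal ((π i ω).real (B i)) :=
        fun ω => ENNReal.ofReal_add (Set.indicator_nonneg (fun _ _ => zero_le_one) _)
          measureReal_nonneg
      simp only [this]
      rw [lintegral_add_right _ (hπm i).ennreal_ofReal, hEπ, hEind,
        ← ENNReal.ofReal_add (hΔF0 i) (hΔF0 i), two_mul]
    · calc ∑ i ∈ S, ‖z n i - ζ i‖ * (2 * ΔF i)
          ≤ ∑ i ∈ S, 2 * s⁻¹ * (‖z n i‖ ^ 2 * ΔF i) := by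
            refine Finset.sum_le_sum fun i _ => ?_
            have := mul_le_mul_of_nonneg_right (norm_sub_truncVec_le hs (z n i)) (hΔF0 i)
            simp only [hζ]
            nlinarith
        _ ≤ 2 * s⁻¹ * s ^ 2 := by
            rw [← Finset.mul_sum]
            gcongr
        _ = 2 * s := by field_simp
  have hμ₂ : μ E₂ ≤ ENNReal.ofReal K⁻¹ := by
    refine measure_lt_weighted_sum_real_le μ S (m := ΔF)
      (fun i _ => by positivity) (fun i _ => hΔF0 i)
      (fun i _ => hπm i) (fun i _ ω => measureReal_nonneg) (fun i _ => (hEπ i).le)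
      (by positivity) hK ?_
    refine (Finset.sum_le_sum fun i _ => ?_).trans hρ'
    have := hΔF0 i
    have := norm_truncVec_le s (z n i)
    gcongr
  have hμ₃ : μ E₃ ≤ ENNReal.ofReal K⁻¹ := by
    refine measure_lt_weighted_sum_le μ S (m := fun _ => L)
      (fun i _ => by positivity) (fun i _ => L.2)
      (fun i _ => (measurable_ratLip _ _).comp (measurable_past hε _)) (fun i _ => ?_)
      hD hK hDsum
    refine (lintegral_ratLip_past_le μ hε hind hid hG n ε₀ _).trans (hL.trans ?_)
    simp
  have hinner : ∀ i, ∀ ϑ : EuclideanSpace ℝ (Fin p), ‖ϑ‖ ≤ δ →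
      |inner ℝ (z n i) ϑ| ≤ ‖z n i‖ * δ := fun i ϑ hϑ =>
    (abs_real_inner_le_norm _ _).trans (by gcongr)
  have hcw : ∀ i, c * w i = ‖z n i‖ * δ := fun i => by simp only [hw]; field_simp
  have hμQ : ∀ f : ℕ → ℝ → ℝ, (∀ i, Measurable (f i)) →
      (∀ i ∈ S, ∀ y, |f i y| ≤ ‖ζ i‖ * (B i).indicator 1 y) →
      μ (Q f) ≤ ENNReal.ofReal (Real.exp (-(a / (2 * s)) + K / 4)) := by
    intro f hf hfB
    -- The tilt 1/(2s) is admissible because truncated norms are at most `s`; with variance cap `K *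
    -- s ^ 2` the quadratic term is the constant K/4.
    have := measure_sum_output_ge_le μ hε hind hid hG hf hBm (fun i => norm_nonneg (ζ i))
      (l := (2 * s)⁻¹) (by positivity) (fun i => by
        have := norm_truncVec_le_level hs.le (z n i)
        have h2 : 2 * (2 * s)⁻¹ * ‖ζ i‖ = ‖ζ i‖ / s := by field_simp
        rw [h2, div_le_one hs]
        exact this) n hfB a (K * s ^ 2)
    refine this.trans (le_of_eq ?_)
    congr 2
    field_simp
    ring
  have hμg : ∀ φ' ∈ P, ∀ k σ, |σ| = 1 →
      μ (Q (fg φ' k σ)) ≤ ENNReal.ofReal (Real.exp (-(a / (2 * s)) + K / 4)) := by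
    intro φ' hφ' k σ hσ
    refine hμQ _ (fun i => ((measurable_stepDiff _ _).const_mul _).const_mul _) fun i hi y => ?_
    simp only [hfg]
    rw [abs_mul, hσ, one_mul, abs_mul]
    refine mul_le_mul ?_ (abs_stepDiff_le hc (hγ i hi) (hw0 i)
      ((hinner i φ' (hP φ' hφ')).trans_eq (hcw i).symm) y) (abs_nonneg _) (norm_nonneg _)
    simpa using PiLp.norm_apply_le (ζ i) k
  have hμo : ∀ φ', μ (Q (fo φ')) ≤ ENNReal.ofReal (Real.exp (-(a / (2 * s)) + K / 4)) := by
    intro φ'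
    refine hμQ _ (fun i => (measurable_one.indicator (measurableSet_oscSet _ _ _ _)).const_mul _)
      fun i hi y => ?_
    simp only [hfo]
    have hO0 : (0 : ℝ) ≤ (O φ' i).indicator 1 y := Set.indicator_nonneg (fun _ _ => zero_le_one) y
    rw [abs_mul, abs_norm, abs_of_nonneg hO0]
    exact mul_le_mul_of_nonneg_left (Set.indicator_le_indicator_of_subset Set.inter_subset_left
      (fun _ => zero_le_one) y) (norm_nonneg _)
  have hcompens : ∀ ω ∉ E₃, ∀ φ' ∈ P, ∑ i ∈ S, ‖ζ i‖ * (π i ω).real (O φ' i) ≤ K * D := by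
    intro ω hω φ' hφ'
    have hω' : ∑ i ∈ S, ENNReal.ofReal (4 * h / c * ‖z n i‖ ^ 2) *
        ratLip (outKernel μ ε G n) ε₀ (past ε (i - 1) ω) ≤ ENNReal.ofReal (K * D) := not_lt.1 hω
    refine (ENNReal.ofReal_le_ofReal_iff (by positivity)).1 (le_trans ?_ hω')
    rw [ENNReal.ofReal_sum_of_nonneg fun i _ => mul_nonneg (norm_nonneg _) measureReal_nonneg]
    refine Finset.sum_le_sum fun i hi => ?_
    -- A zero vector would give a degenerate interval, excluded by `kernel_Icc_le_ratLip`, but it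
    -- contributes nothing.
    rcases eq_or_ne (z n i) 0 with hz | hz
    · have : ζ i = 0 := by simp [hζ, hz, truncVec]
      simp [this]
    have hzpos : 0 < ‖z n i‖ := norm_pos_iff.2 hz
    have hγi : c ≤ γ n i := hγ i hi
    have hγ0 : 0 < γ n i := hc.trans_le hγi
    obtain ⟨ht1, ht2⟩ := abs_le.1 (hinner i φ' (hP φ' hφ'))
    have hwi := hwin i hi
    have hcε : 0 < c * ε₀ := lt_of_le_of_lt (by positivity) hwi
    have hε₀ : 0 < ε₀ := pos_of_mul_pos_right hcε hc.le
    have hγε : c * ε₀ ≤ γ n i * ε₀ := by gcongr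
    -- Dividing by `γ n i ≥ c` keeps the interval inside (-ε₀, ε₀) by `hwin`. Its length is at most
    -- 2h‖z‖/c, which the lemma doubles to 4h‖z‖/c.
    have hker := kernel_Icc_le_ratLip (outKernel μ ε G n) (ε₀ := ε₀)
      (a := (inner ℝ (z n i) φ' - ‖z n i‖ * h) / γ n i)
      (b := (inner ℝ (z n i) φ' + ‖z n i‖ * h) / γ n i) (past ε (i - 1) ω)
      (by rw [lt_div_iff₀ hγ0]; nlinarith)
      (by
        have : 0 < ‖z n i‖ * h := by positivity
        gcongr
        linarith)
      (by rw [div_lt_iff₀ hγ0]; nlinarith)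
    rw [ENNReal.ofReal_mul (norm_nonneg _), ofReal_measureReal]
    calc ENNReal.ofReal ‖ζ i‖ * π i ω (O φ' i)
        ≤ ENNReal.ofReal ‖z n i‖ * (ratLip (outKernel μ ε G n) ε₀ (past ε (i - 1) ω) *
            ENNReal.ofReal (4 * h / c * ‖z n i‖)) := by
          gcongr
          · exact norm_truncVec_le s (z n i)
          · simp only [hπ]
            rw [condLaw_eq μ hε hind hid hG]
            refine (measure_mono (oscSet_subset_Icc hγ0)).trans (hker.trans ?_)
            have : 2 * ((inner ℝ (z n i) φ' + ‖z n i‖ * h) / γ n i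
                - (inner ℝ (z n i) φ' - ‖z n i‖ * h) / γ n i) = 4 * h / γ n i * ‖z n i‖ := by
              field_simp
              ring
            rw [this]
            gcongr
      _ = ENNReal.ofReal (4 * h / c * ‖z n i‖ ^ 2) *
            ratLip (outKernel μ ε G n) ε₀ (past ε (i - 1) ω) := by
          rw [mul_left_comm, ← ENNReal.ofReal_mul (norm_nonneg _), mul_comm]
          congr 2
          ring
  have hsub : {ω | ENNReal.ofReal (K * (2 * s) + p * a + a + 2 * (K * D)) <
        ⨆ φ ∈ Metric.closedBall (0 : EuclideanSpace ℝ (Fin p)) δ,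
          ‖martPart μ ε G α γ z n φ ω - martPart μ ε G α γ z n 0 ω‖ₑ} ⊆
      E₁ ∪ E₂ ∪ E₃ ∪ ⋃ φ' ∈ P, ((⋃ k ∈ (Finset.univ : Finset (Fin p)),
        (Q (fg φ' k 1) ∪ Q (fg φ' k (-1)))) ∪ Q (fo φ')) := by
    intro ω
    contrapose!
    intro hω
    simp only [Set.mem_union, Set.mem_iUnion, not_or, not_exists, Finset.mem_univ,
      forall_true_left] at hω
    obtain ⟨⟨⟨h1, h2⟩, h3⟩, h4⟩ := hω
    have hVω : V ω ≤ K * s ^ 2 := not_lt.1 h2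
    have hQa : ∀ f, ω ∉ Q f → ∑ i ∈ S, (f i (e i ω) - ∫ y, f i y ∂π i ω) ≤ a := fun f hf => by
      by_contra! hlt
      exact hf ⟨hlt.le, hVω⟩
    rw [Set.mem_ofPred_eq, not_lt]
    refine iSup₂_le fun φ hφ => ?_
    rw [mem_closedBall_zero_iff] at hφ
    obtain ⟨φ', hφ'P, hφφ'⟩ := hcov φ hφ
    obtain ⟨h5, h6⟩ := h4 φ' hφ'P
    rw [← ofReal_norm, martPart_sub_martPart_zero, norm_neg]
    refine ENNReal.ofReal_le_ofReal ?_
    refine (norm_sum_centered_stepDiff_le S (fun i => e i ω) (fun i => π i ω) s hc hδ.le hγ (z n)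
      hφ (hP φ' hφ'P) hφφ').trans ?_
    refine add_le_add (add_le_add (add_le_add (not_lt.1 h1) ?_) (hQa _ h6))
      (mul_le_mul_of_nonneg_left (hcompens ω h3 φ' hφ'P) zero_le_two)
    calc _ ≤ ∑ _k : Fin p, a := Finset.sum_le_sum fun k _ => ?_
      _ = p * a := by simp
    have hp := hQa _ (h5 k).1
    have hn := hQa _ (h5 k).2
    simp only [hfg, one_mul, neg_mul, integral_neg, sub_neg_eq_add, neg_add_eq_sub] at hp hn
    refine abs_le.2 ⟨?_, hp⟩
    rw [neg_le, ← Finset.sum_neg_distrib]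
    simpa only [neg_sub] using hn
  set q := ENNReal.ofReal (Real.exp (-(a / (2 * s)) + K / 4)) with hq
  refine (measure_mono hsub).trans ((measure_union_le _ _).trans (add_le_add ?_ ?_))
  · exact (measure_union_le _ _).trans (add_le_add ((measure_union_le _ _).trans
      (add_le_add hμ₁ hμ₂)) hμ₃)
  · refine (measure_biUnion_finset_le _ _).trans ?_
    refine (Finset.sum_le_card_nsmul _ _ ((2 * p + 1) * q) fun φ' hφ' => ?_).trans_eq
      (nsmul_eq_mul _ _)
    refine (measure_union_le _ _).trans ?_
    rw [add_mul, one_mul]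
    refine add_le_add ((measure_biUnion_finset_le _ _).trans ?_) (hμo φ')
    refine (Finset.sum_le_card_nsmul _ _ (2 * q) fun k _ => ?_).trans_eq ?_
    · rw [two_mul]
      exact (measure_union_le _ _).trans (add_le_add (hμg φ' hφ' k 1 (by simp))
        (hμg φ' hφ' k (-1) (by simp)))
    · simp only [Finset.card_univ, Fintype.card_fin, nsmul_eq_mul]
      ring

end FixedSample

/-! ### A lattice net of the ball. -/

section Net

/-- Rounding toward zero never enlarges a coordinate, so the lattice approximation of a point of the
ball stays in the ball, where the window bounds apply. -/
theorem exists_int_toward_zero (x : ℝ) : ∃ m : ℤ, |(m : ℝ)| ≤ |x| ∧ |x - m| ≤ 1 := by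
  rcases le_total 0 x with hx | hx
  · refine ⟨⌊x⌋, ?_, ?_⟩
    · rw [abs_of_nonneg (by exact_mod_cast Int.floor_nonneg.2 hx), abs_of_nonneg hx]
      exact Int.floor_le x
    · rw [abs_le]
      constructor <;> linarith [Int.floor_le x, Int.lt_floor_add_one x]
  · refine ⟨⌈x⌉, ?_, ?_⟩
    · rw [abs_of_nonpos (by exact_mod_cast Int.ceil_le.2 (by simpa using hx)), abs_of_nonpos hx]
      linarith [Int.le_ceil x]
    · rw [abs_le]
      constructor <;> linarith [Int.le_ceil x, Int.ceil_lt_add_one x]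

/-- A lattice net of a Euclidean ball, contained in the ball. -/
theorem exists_net_closedBall (p : ℕ) {δ : ℝ} (hδ : 0 < δ) {N : ℕ} (hN : 0 < N) :
    ∃ P : Finset (EuclideanSpace ℝ (Fin p)), P.card ≤ (2 * N + 1) ^ p ∧ (∀ φ ∈ P, ‖φ‖ ≤ δ) ∧
      ∀ φ : EuclideanSpace ℝ (Fin p), ‖φ‖ ≤ δ → ∃ φ' ∈ P, ‖φ - φ'‖ ≤ p * (δ / N) := by
  classical
  have hN' : (0 : ℝ) < N := by exact_mod_cast hN
  set g : (Fin p → ℤ) → EuclideanSpace ℝ (Fin p) := fun m =>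
    WithLp.toLp 2 fun k => (m k : ℝ) * (δ / N) with hg
  refine ⟨((Fintype.piFinset fun _ : Fin p => Finset.Icc (-(N : ℤ)) N).image g).filter
    fun φ => ‖φ‖ ≤ δ, ?_, fun φ hφ => (Finset.mem_filter.1 hφ).2, fun φ hφ => ?_⟩
  · refine (Finset.card_filter_le _ _).trans (Finset.card_image_le.trans ?_)
    rw [Fintype.card_piFinset]
    simp only [Int.card_Icc, Finset.prod_const, Finset.card_univ, Fintype.card_fin]
    gcongr
    omega
  · choose m hm1 hm2 using fun k => exists_int_toward_zero (φ k * (N / δ))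
    have hφk : ∀ k, |φ k| ≤ δ := fun k => by
      simpa using (PiLp.norm_apply_le φ k).trans hφ
    have habs : ∀ k, |φ k * (N / δ)| = |φ k| * (N / δ) := fun k => by
      rw [abs_mul, abs_of_pos (show (0 : ℝ) < N / δ by positivity)]
    have hgk : ∀ k, |g m k| ≤ |φ k| := fun k => by
      have h1 : |g m k| = |(m k : ℝ)| * (δ / N) := by
        simp only [hg]
        rw [abs_mul, abs_of_pos (show (0 : ℝ) < δ / N by positivity)]
      have h2 := hm1 k
      rw [habs] at h2
      rw [h1]
      calc |(m k : ℝ)| * (δ / N) ≤ |φ k| * (N / δ) * (δ / N) := by gcongr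
        _ = |φ k| := by field_simp
    refine ⟨g m, Finset.mem_filter.2 ⟨Finset.mem_image_of_mem _ (Fintype.mem_piFinset.2
      fun k => ?_), le_trans ?_ hφ⟩, ?_⟩
    · have h1 : |(m k : ℝ)| ≤ N := by
        refine (hm1 k).trans ?_
        rw [habs]
        calc |φ k| * (N / δ) ≤ δ * (N / δ) := by gcongr; exact hφk k
          _ = N := by field_simp
      have h2 : |m k| ≤ (N : ℤ) := by exact_mod_cast h1
      exact Finset.mem_Icc.2 (abs_le.1 h2)
    · rw [EuclideanSpace.norm_eq, EuclideanSpace.norm_eq]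
      gcongr with k
      exact hgk k
    · refine (euclidean_norm_le_sum_abs _).trans ?_
      calc ∑ k, |(φ - g m) k| ≤ ∑ _k : Fin p, δ / N := by
            refine Finset.sum_le_sum fun k _ => ?_
            have h1 : (φ - g m) k = (φ k * (N / δ) - m k) * (δ / N) := by
              simp only [hg, PiLp.sub_apply]
              field_simp
            rw [h1, abs_mul, abs_of_pos (show (0 : ℝ) < δ / N by positivity)]
            exact mul_le_of_le_one_left (by positivity) (hm2 k)
        _ = p * (δ / N) := by simp

end Net

/-! ### Normalisation of the design vectors. -/

section Design

variable {p : ℕ}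

theorem secondMoment_posSemidef (x : ℕ → ℕ → EuclideanSpace ℝ (Fin p)) (n : ℕ) :
    (secondMoment x n).PosSemidef := by
  unfold secondMoment
  refine Matrix.PosSemidef.smul (Matrix.posSemidef_sum _ fun i _ => ?_) (by positivity)
  simpa using Matrix.posSemidef_vecMulVec_self_star (x n i).ofLp

theorem cfc_inv_sqrt_mul_mul {S : Matrix (Fin p) (Fin p) ℝ} (hS : S.PosSemidef)
    (hdet : IsUnit S.det) :
    cfc (fun t : ℝ => (Real.sqrt t)⁻¹) S * S * cfc (fun t : ℝ => (Real.sqrt t)⁻¹) S = 1 := by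
  have hpd : S.PosDef := hS.posDef_iff_isUnit.2 ((Matrix.isUnit_iff_isUnit_det S).2 hdet)
  have hspec : ∀ t ∈ spectrum ℝ S, 0 < t := by
    intro t ht
    rw [hpd.1.spectrum_real_eq_range_eigenvalues] at ht
    obtain ⟨i, rfl⟩ := ht
    exact hpd.eigenvalues_pos i
  have hsa : IsSelfAdjoint S := hpd.1
  have hcont : ContinuousOn (fun t : ℝ => (Real.sqrt t)⁻¹) (spectrum ℝ S) :=
    Real.continuous_sqrt.continuousOn.inv₀ fun t ht => (Real.sqrt_pos.2 (hspec t ht)).ne'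
  have hcont' : ContinuousOn (fun t : ℝ => (Real.sqrt t)⁻¹ * t) (spectrum ℝ S) :=
    hcont.mul continuousOn_id
  have hidc : ContinuousOn (fun t : ℝ => t) (spectrum ℝ S) := continuousOn_id
  calc cfc (fun t : ℝ => (Real.sqrt t)⁻¹) S * S * cfc (fun t : ℝ => (Real.sqrt t)⁻¹) S
      = cfc (fun t : ℝ => (Real.sqrt t)⁻¹) S * cfc (fun t : ℝ => t) S *
          cfc (fun t : ℝ => (Real.sqrt t)⁻¹) S := by rw [cfc_id' ℝ S]
    _ = cfc (fun t : ℝ => (Real.sqrt t)⁻¹ * t * (Real.sqrt t)⁻¹) S := by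
        rw [← cfc_mul _ _ S hcont hidc, ← cfc_mul _ _ S hcont' hcont]
    _ = cfc (fun _ : ℝ => (1 : ℝ)) S := by
        refine cfc_congr fun t ht => ?_
        have h0 := Real.sqrt_pos.2 (hspec t ht)
        have h1 := Real.mul_self_sqrt (hspec t ht).le
        field_simp
        nlinarith
    _ = 1 := cfc_const_one ℝ S

/-- Each squared norm is the trace of A x xᵀ A with A = Σ^{-1/2}; summing gives n · tr(A Σ A) = n ·
tr(I). -/
theorem sum_norm_sq_rescaled (x : ℕ → ℕ → EuclideanSpace ℝ (Fin p)) {n : ℕ} (hn : 0 < n)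
    (hdet : IsUnit (secondMoment x n).det) :
    ∑ i ∈ Finset.Icc 1 n, ‖rescaled x n i‖ ^ 2 = n * p := by
  have hn' : (n : ℝ) ≠ 0 := by exact_mod_cast hn.ne'
  set S := secondMoment x n with hS
  set A := cfc (fun t : ℝ => (Real.sqrt t)⁻¹) S with hA
  have hAt : A.transpose = A := by
    have h := Matrix.isHermitian_iff_isSelfAdjoint.2 (cfc_predicate _ S : IsSelfAdjoint A)
    rwa [Matrix.IsHermitian, Matrix.conjTranspose_eq_transpose_of_trivial] at h
  have hsum : ∑ i ∈ Finset.Icc 1 n, Matrix.vecMulVec (x n i).ofLp (x n i).ofLp = (n : ℝ) • S := by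
    rw [hS, secondMoment, smul_smul, mul_inv_cancel₀ hn', one_smul]
  have hterm : ∀ i, ‖rescaled x n i‖ ^ 2 =
      (A * Matrix.vecMulVec (x n i).ofLp (x n i).ofLp * A).trace := by
    intro i
    rw [Matrix.mul_vecMulVec, Matrix.vecMulVec_mul, Matrix.trace_vecMulVec,
      ← Matrix.mulVec_transpose, hAt, EuclideanSpace.norm_sq_eq]
    simp [dotProduct, rescaled, ← hS, ← hA, sq]
  simp_rw [hterm]
  rw [← Matrix.trace_sum, ← Finset.sum_mul, ← Finset.mul_sum, hsum, Matrix.mul_smul,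
    Matrix.smul_mul, cfc_inv_sqrt_mul_mul (secondMoment_posSemidef x n) hdet, Matrix.trace_smul,
    Matrix.trace_one, Fintype.card_fin, smul_eq_mul]

theorem norm_le_maxNorm (z : ℕ → ℕ → EuclideanSpace ℝ (Fin p)) {n i : ℕ}
    (hi : i ∈ Finset.Icc 1 n) : ‖z n i‖ ≤ maxNorm z n := by
  have := Finset.le_sup (f := fun i => ‖z n i‖₊) hi
  exact_mod_cast this

/-- The mean squared norm is p ≥ 1, so the maximum is at least 1. This is what turns δ_n r_n → 0
into a bound on δ_n itself. -/
theorem one_le_maxNorm_rescaled (hp : 0 < p) (x : ℕ → ℕ → EuclideanSpace ℝ (Fin p)) {n : ℕ}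
    (hn : 0 < n) (hdet : IsUnit (secondMoment x n).det) : 1 ≤ maxNorm (rescaled x) n := by
  have hr0 : 0 ≤ maxNorm (rescaled x) n := NNReal.coe_nonneg _
  have hp1 : (1 : ℝ) ≤ p := by exact_mod_cast hp
  have hn' : (0 : ℝ) < n := by exact_mod_cast hn
  have h : (n : ℝ) * p ≤ n * maxNorm (rescaled x) n ^ 2 := by
    rw [← sum_norm_sq_rescaled x hn hdet]
    refine (Finset.sum_le_card_nsmul _ _ (maxNorm (rescaled x) n ^ 2) fun i hi => ?_).trans_eq ?_
    · exact pow_le_pow_left₀ (norm_nonneg _) (norm_le_maxNorm _ hi) 2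
    · simp
  have h2 := le_of_mul_le_mul_left h hn'
  nlinarith

end Design

/-! ### Elementary bounds for the final union. -/

section Asymptotics

theorem rho_nonneg {Ω E : Type*} [MeasurableSpace Ω] {p : ℕ} (μ : Measure Ω)
    [IsFiniteMeasure μ] (ε : ℤ → Ω → E) (G : ℕ → (ℕ → E) → ℝ) {c : ℝ} (hc : 0 < c)
    (z : ℕ → ℕ → EuclideanSpace ℝ (Fin p)) (n : ℕ) {δ : ℝ} (hδ : 0 ≤ δ) :
    0 ≤ rho μ ε G c z n δ := by
  refine Finset.sum_nonneg fun i _ => mul_nonneg (by positivity)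
    (sub_nonneg.2 (margCdf_mono μ ε G n ?_))
  have : 0 ≤ c⁻¹ * ‖z n i‖ * δ := by positivity
  linarith

/-- The net costs a factor of order n^{4p}; the exponent 4p + 1 leaves one spare power of n to send
the bound to zero. -/
theorem net_union_bound_le (p : ℕ) {n : ℕ} (hn : 0 < n) (K : ℝ) :
    ((2 * (n : ℝ) ^ 4 + 1) ^ p) * ((2 * p + 1) *
        Real.exp (-((4 * p + 1 : ℕ) * Real.log n) + K / 4))
      ≤ 3 ^ p * (2 * p + 1) * Real.exp (K / 4) / n := by
  have hn1 : (1 : ℝ) ≤ n := by exact_mod_cast hn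
  have hn0 : (0 : ℝ) < n := by linarith
  have hexp : Real.exp (-((4 * p + 1 : ℕ) * Real.log n)) = ((n : ℝ) ^ (4 * p + 1))⁻¹ := by
    rw [Real.exp_neg, Real.exp_nat_mul, Real.exp_log hn0]
  have hpow : (2 * (n : ℝ) ^ 4 + 1) ^ p ≤ 3 ^ p * (n : ℝ) ^ (4 * p) := by
    rw [pow_mul, ← mul_pow]
    gcongr
    linarith [one_le_pow₀ hn1 (n := 4)]
  rw [Real.exp_add, hexp]
  calc (2 * (n : ℝ) ^ 4 + 1) ^ p * ((2 * p + 1) * (((n : ℝ) ^ (4 * p + 1))⁻¹ * Real.exp (K / 4)))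
      ≤ 3 ^ p * (n : ℝ) ^ (4 * p) *
          ((2 * p + 1) * (((n : ℝ) ^ (4 * p + 1))⁻¹ * Real.exp (K / 4))) := by gcongr
    _ = 3 ^ p * (2 * p + 1) * Real.exp (K / 4) / n := by
        rw [pow_succ]
        field_simp

end Asymptotics

end HighQuantile

/-! ### Choice of constants and conclusion. -/

open HighQuantile in
theorem lemma1
    {Ω E : Type*} [MeasurableSpace Ω] [MeasurableSpace E]
    (μ : Measure Ω) [IsProbabilityMeasure μ]
    -- i.i.d. innovations and the measurable systems `G_n`
    (ε : ℤ → Ω → E) (hε_meas : ∀ k, Measurable (ε k)) (hε_indep : iIndepFun ε μ)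
    (hε_ident : ∀ k, IdentDistrib (ε k) (ε 0) μ μ)
    (G : ℕ → (ℕ → E) → ℝ) (hG : ∀ n, Measurable (G n))
    -- zero is the `(1 - α_n)`-th quantile of the auxiliary variables
    (α : ℕ → ℝ) (hquant : ∀ n : ℕ, 1 ≤ n → HighQuantile.margCdf μ ε G n 0 = 1 - α n)
    (hα : Tendsto α atTop (𝓝 0)) (hnα : Tendsto (fun n : ℕ => (n : ℝ) * α n) atTop atTop)
    -- the design
    {p : ℕ} (x : ℕ → ℕ → EuclideanSpace ℝ (Fin p))
    (hx : ∀ᶠ n in atTop, IsUnit (HighQuantile.secondMoment x n).det)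
    -- bounded heteroskedasticity
    (γ : ℕ → ℕ → ℝ) (hγ_pos : ∀ n, ∀ i ∈ Finset.Icc 1 n, 0 < γ n i)
    (hγ_mean : ∀ n : ℕ, 1 ≤ n → (n : ℝ)⁻¹ * ∑ i ∈ Finset.Icc 1 n, γ n i = 1)
    (c₁ c₂ : ℝ) (hc₁ : 0 < c₁) (hc₁₂ : c₁ ≤ c₂)
    (hγ : ∀ᶠ n in atTop, ∀ i ∈ Finset.Icc 1 n, c₁ ≤ γ n i ∧ γ n i ≤ c₂)
    -- stochastic Lipschitz continuity near zero, with `L_{0,n}` bounded in `L¹`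
    (ε₀ : ℝ) (hε₀ : 0 < ε₀)
    (hL : ∃ C : ℝ≥0, ∀ᶠ n in atTop, ∫⁻ ω, HighQuantile.lipConst μ ε G ε₀ n ω ∂μ ≤ C)
    (δ : ℕ → ℝ) (hδ : ∀ n, 0 < δ n)
    (hδr : Tendsto (fun n => δ n * HighQuantile.maxNorm (HighQuantile.rescaled x) n)
      atTop (𝓝 0)) :
    HighQuantile.IsBigOp μ
      (fun n ω => ⨆ φ ∈ Metric.closedBall (0 : EuclideanSpace ℝ (Fin p)) (δ n),
        ‖HighQuantile.martPart μ ε G α γ (HighQuantile.rescaled x) n φ ω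
          - HighQuantile.martPart μ ε G α γ (HighQuantile.rescaled x) n 0 ω‖ₑ)
      (fun n => Real.sqrt (HighQuantile.rho μ ε G c₁ (HighQuantile.rescaled x) n (δ n))
          * Real.log n
        + HighQuantile.maxNorm (HighQuantile.rescaled x) n ^ 2 * ((n : ℝ) ^ 3)⁻¹) := by
  intro η hη
  -- In dimension zero r_n = 0, so the bound r_n ≥ 1 fails, but every vector vanishes.
  rcases Nat.eq_zero_or_pos p with rfl | hp
  · refine ⟨0, .of_forall fun n => ?_⟩
    have : ∀ v : EuclideanSpace ℝ (Fin 0), ‖v‖ₑ = 0 := fun v => by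
      rw [Subsingleton.elim v 0, enorm_zero]
    simp [this]
  obtain ⟨L, hL⟩ := hL
  obtain ⟨η', hη'0, hη'⟩ : ∃ η' : ℝ, 0 < η' ∧ ENNReal.ofReal η' ≤ η := by
    refine ⟨(min η 1).toReal, ENNReal.toReal_pos (lt_min hη one_pos).ne' (by simp), ?_⟩
    rw [ENNReal.ofReal_toReal (by simp)]
    exact min_le_left _ _
  -- The three Markov events cost 3/K = η'/2; the other half is left for the union over the net.
  set K : ℝ := 6 / η' with hK
  have hK0 : 0 < K := by positivity
  -- With a = A s log n the exponent a/(2s) becomes (4p + 1) log n.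
  set A : ℝ := 2 * (4 * p + 1 : ℕ) with hA
  have hA0 : 0 ≤ A := by positivity
  set M : ℝ := 4 * p * L / c₁ + 1 with hM
  have hM0 : 0 < M := by positivity
  set C : ℝ := 2 * K + (p + 1) * A + 2 * K * M with hC
  have hC0 : 0 ≤ C := by positivity
  have hsmall : ∀ᶠ n : ℕ in atTop, 3 ^ p * (2 * p + 1) * Real.exp (K / 4) / (n : ℝ) ≤ η' / 2 :=
    ((tendsto_const_div_atTop_nhds_zero_nat _).eventually_lt_const (by positivity)).mono
      fun n hn => hn.le
  have hδ1 := hδr.eventually_lt_const (show (0 : ℝ) < 1 from one_pos)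
  have hδ2 := hδr.eventually_lt_const (show (0 : ℝ) < c₁ * ε₀ / (1 + p) by positivity)
  refine ⟨C.toNNReal, ?_⟩
  filter_upwards [hx, hγ, hL, hsmall, hδ1, hδ2, eventually_ge_atTop 3] with
    n hxn hγn hLn hsmalln hδ1n hδ2n hn
  set r := maxNorm (rescaled x) n with hr
  set ρ := rho μ ε G c₁ (rescaled x) n (δ n) with hρ
  have hρ0 : 0 ≤ ρ := rho_nonneg μ ε G hc₁ _ n (hδ n).le
  have hr1 : 1 ≤ r := one_le_maxNorm_rescaled hp x (by omega) hxn
  have hn3 : (3 : ℝ) ≤ n := by exact_mod_cast hn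
  have hn0 : (0 : ℝ) < n := by linarith
  have hlog : 1 ≤ Real.log n := by
    rw [Real.le_log_iff_exp_le hn0]
    exact Real.exp_one_lt_three.le.trans hn3
  have hlog0 : 0 < Real.log n := by linarith
  set R := r ^ 2 * ((n : ℝ) ^ 3)⁻¹ with hR
  have hR0 : 0 < R := by positivity
  -- Chosen so that s log n is exactly the target rate; the second term keeps s positive even when ϱ
  -- vanishes.
  set s := Real.sqrt ρ + R / Real.log n with hs
  have hs0 : 0 < s := by positivity
  set b := Real.sqrt ρ * Real.log n + R with hb
  have hsb : s * Real.log n = b := by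
    rw [hs, hb]
    field_simp
  have hsle : s ≤ b := by
    rw [← hsb]
    exact le_mul_of_one_le_right hs0.le hlog
  have hRb : R ≤ b := by
    rw [hb]
    have : 0 ≤ Real.sqrt ρ * Real.log n := by positivity
    linarith
  have hρs : ρ ≤ s ^ 2 := by
    calc ρ = Real.sqrt ρ ^ 2 := (Real.sq_sqrt hρ0).symm
      _ ≤ s ^ 2 := by
        gcongr
        rw [hs]
        have : 0 ≤ R / Real.log n := by positivity
        linarith
  have hδ0 := hδ n
  have hδle : δ n ≤ 1 := (le_mul_of_one_le_right hδ0.le hr1).trans hδ1n.le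
  have hp' : (0 : ℝ) < p := by exact_mod_cast hp
  obtain ⟨P, hPcard, hPδ, hPcov⟩ := exists_net_closedBall p hδ0 (N := n ^ 4) (by positivity)
  set h : ℝ := p * (δ n / (n ^ 4 : ℕ)) with hh
  have hh0 : 0 < h := by positivity
  -- The mesh enlarges the window at most by the factor 1 + p, which explains the threshold in
  -- `hδ2`.
  have hhδ : h ≤ p * δ n := by
    rw [hh]
    gcongr
    refine div_le_self hδ0.le ?_
    exact_mod_cast Nat.one_le_pow _ _ (by omega)
  have hwin : ∀ i ∈ Finset.Icc 1 n, ‖rescaled x n i‖ * (δ n + h) < c₁ * ε₀ := by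
    intro i hi
    rw [lt_div_iff₀ (by positivity)] at hδ2n
    calc ‖rescaled x n i‖ * (δ n + h) ≤ r * (δ n + p * δ n) := by
          gcongr
          exact norm_le_maxNorm _ hi
      _ = δ n * r * (1 + p) := by ring
      _ < c₁ * ε₀ := hδ2n
  -- With δ_n ≤ 1 and ‖z‖ ≤ r_n, the n terms are each of order n⁻⁴ r_n², giving n⁻³ r_n² in total.
  have hDsum : ∑ i ∈ Finset.Icc 1 n, 4 * h / c₁ * ‖rescaled x n i‖ ^ 2 * L ≤ M * R := by
    calc ∑ i ∈ Finset.Icc 1 n, 4 * h / c₁ * ‖rescaled x n i‖ ^ 2 * L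
        ≤ ∑ _i ∈ Finset.Icc 1 n, 4 * (p * (1 / (n : ℝ) ^ 4)) / c₁ * r ^ 2 * L := by
          refine Finset.sum_le_sum fun i hi => ?_
          have := norm_le_maxNorm (rescaled x) hi
          rw [hh]
          push_cast
          gcongr
      _ = 4 * p * L / c₁ * R := by
          rw [Finset.sum_const, Nat.card_Icc, nsmul_eq_mul, hR]
          push_cast
          field_simp
      _ ≤ M * R := by
          gcongr
          rw [hM]
          linarith
  have key := measure_sup_martPart_le μ hε_meas hε_indep hε_ident hG α γ (rescaled x) n
    (A * b) hc₁ hδ0 hh0 hs0 hK0 (mul_pos hM0 hR0) (fun i hi => (hγn i hi).1) hρs hLn hwin hDsum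
    P hPδ hPcov
  refine (measure_mono ?_).trans (key.trans (le_trans ?_ hη'))
  · intro ω hω
    rw [Set.mem_ofPred_eq] at hω ⊢
    refine lt_of_le_of_lt ?_ hω
    rw [← ENNReal.ofReal_coe_nnreal, Real.coe_toNNReal _ hC0, ← ENNReal.ofReal_mul hC0]
    refine ENNReal.ofReal_le_ofReal ?_
    have h1 : K * (2 * s) ≤ K * (2 * b) := by gcongr
    have h2 : 2 * (K * (M * R)) ≤ 2 * (K * (M * b)) := by gcongr
    rw [hC]
    linarith
  · have hexp : -(A * b / (2 * s)) = -((4 * p + 1 : ℕ) * Real.log n) := by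
      rw [hA, ← hsb]
      field_simp
    have hcard : (P.card : ℝ≥0∞) ≤ ENNReal.ofReal ((2 * (n : ℝ) ^ 4 + 1) ^ p) := by
      rw [← ENNReal.ofReal_natCast]
      refine ENNReal.ofReal_le_ofReal ?_
      exact_mod_cast hPcard
    have h2p : (2 * p + 1 : ℝ≥0∞) = ENNReal.ofReal (2 * p + 1) := by
      rw [ENNReal.ofReal_add (by positivity) zero_le_one, ENNReal.ofReal_mul zero_le_two]
      simp
    rw [hexp, h2p, ← ENNReal.ofReal_mul (by positivity)]
    calc _ ≤ ENNReal.ofReal K⁻¹ + ENNReal.ofReal K⁻¹ + ENNReal.ofReal K⁻¹ +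
          ENNReal.ofReal ((2 * (n : ℝ) ^ 4 + 1) ^ p) * ENNReal.ofReal ((2 * p + 1) *
            Real.exp (-((4 * p + 1 : ℕ) * Real.log n) + K / 4)) := by gcongr
      _ = ENNReal.ofReal (K⁻¹ + K⁻¹ + K⁻¹ + ((2 * (n : ℝ) ^ 4 + 1) ^ p) * ((2 * p + 1) *
            Real.exp (-((4 * p + 1 : ℕ) * Real.log n) + K / 4))) := by
          rw [← ENNReal.ofReal_mul (by positivity), ← ENNReal.ofReal_add (by positivity)
            (by positivity), ← ENNReal.ofReal_add (by positivity) (by positivity),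
            ← ENNReal.ofReal_add (by positivity) (by positivity)]
      _ ≤ ENNReal.ofReal η' := by
          refine ENNReal.ofReal_le_ofReal ?_
          have h1 := (net_union_bound_le p (by omega : 0 < n) K).trans hsmalln
          have h2 : K⁻¹ + K⁻¹ + K⁻¹ = η' / 2 := by
            rw [hK]
            field_simp
            norm_num
          linarith
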